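/- Let $\mathbb{R}_+=(0,\infty)$ and $1/2<p<1$. A measurable function $a:\mathbb{R}_+\to\mathbb{C}$ is a $(p,\infty)$-atom if either (i) there are $0\le b<c<\infty$ with $\operatorname{supp} a\subset[b,c]$, $\int_0^\infty a(x)\,dx=0$ and $\|a\|_\infty\le (c-b)^{-1/p}$, or (ii) $a=b^{-1/p}\chi_{(0,b)}$ for some $b>0$. Let $\mathcal{S}(\mathbb{R}_+)$ be the space of Schwartz functions on $\mathbb{R}$ that vanish outside $\mathbb{R}_+$, with the topology induced by the Schwartz space of $\mathbb{R}$, and let $\mathcal{S}'(\mathbb{R}_+)$ be its dual. The Hardy space $H^p(\mathbb{R}_+)$ consists of the $u\in\mathcal{S}'(\mathbb{R}_+)$ that can be written as $u=\sum_{i=1}^\infty\alpha_i a_i$ with convergence in $\mathcal{S}'(\mathbb{R}_+)$, where the $a_i$ are $(p,\infty)$-atoms, $\alpha_i\in\mathbb{C}$ and $\sum_i|\alpha_i|^p<\infty$; its quasi-norm $\|u\|_{H^p(\mathbb{R}_+)}$ is the infimum of $\left(\sum_i|\alpha_i|^p\right)^{1/p}$ over all such decompositions, and its dual $(H^p(\mathbb{R}_+))'$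 consists of the linear functionals $T$ on $H^p(\mathbb{R}_+)$ with $|\langle T,u\rangle|\le C\|u\|_{H^p(\mathbb{R}_+)}$ for some constant $C$. For $0<\alpha<1$ let $C^\alpha_+$ be the space of continuous functions $f:\mathbb{R}_+\to\mathbb{C}$ such that $$\sup_{x\ne y}\frac{|f(x)-f(y)|}{|x-y|^\alpha}+\sup_{x>0}x^{-\alpha}|f(x)|<\infty .$$ Then the dual space of $H^p(\mathbb{R}_+)$ coincides with $C^{(1-p)/p}_+$ in the following sense. For every $T\in(H^p(\mathbb{R}_+))'$ there exists a unique $f\in C^{(1-p)/p}_+$ such that $$\langle T,g\rangle=\int_0^\infty f(y)g(y)\,dy\quad\text{for every finite linear combination } g \text{ of } (p,\infty)\text{-atoms}.$$ Conversely, if $f\in C^{(1-p)/p}_+$, then the mapping $g\mapsto\int_0^\infty f(y)g(y)\,dy$, defined on the finite linear combinations $g$ of $(p,\infty)$-atoms, extends uniquely to an element of $(H^p(\mathbb{R}_+))'$. (All these integrals converge absolutely.) -/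

import Mathlib

open MeasureTheory Filter Topology SchwartzMap

/-- The open half-line `(0, ∞)`, with the restriction of Lebesgue measure as `volume`. -/
abbrev HalfLine : Type := Set.Ioi (0 : ℝ)

noncomputable instance instMeasureSpaceHalfLine : MeasureSpace HalfLine where
  volume := Measure.comap Subtype.val volume

/-- The norm of the Hölder space on the half-line,
`sup_{x ≠ y} |f x - f y| / |x - y| ^ α + sup_x x ^ (-α) |f x|`, with values in `[0, ∞]`. -/
noncomputable def holderPlusNorm (α : ℝ) (f : HalfLine → ℂ) : ENNReal :=
  (⨆ (x : HalfLine) (y : HalfLine) (_ : x ≠ y),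
      ENNReal.ofReal (‖f x - f y‖ / |(x : ℝ) - (y : ℝ)| ^ α)) +
    ⨆ x : HalfLine, ENNReal.ofReal ((x : ℝ) ^ (-α) * ‖f x‖)

/-- Membership in the Hölder space `C^α_+`: continuous functions of finite norm. -/
def MemHolderPlus (α : ℝ) (f : HalfLine → ℂ) : Prop :=
  Continuous f ∧ holderPlusNorm α f < ⊤

/-- `(p, ∞)`-atoms on the half-line: cancelling atoms on an interval `[b, c]`, `0 ≤ b < c < ∞`,
and the functions `b ^ (-1/p) χ_{(0, b)}`, `b > 0`. -/
def IsHardyAtom (p : ℝ) (a : HalfLine → ℂ) : Prop :=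
  (∃ b c : ℝ, 0 ≤ b ∧ b < c ∧ Measurable a ∧
      (∀ x : HalfLine, (x : ℝ) ∉ Set.Icc b c → a x = 0) ∧
      ∫ x, a x = 0 ∧
      eLpNorm a ⊤ volume ≤ ENNReal.ofReal ((c - b) ^ (-1 / p))) ∨
    ∃ b : ℝ, 0 < b ∧
      a = Set.indicator {x : HalfLine | (x : ℝ) < b} (fun _ => ((b ^ (-1 / p) : ℝ) : ℂ))

/-- The Schwartz space of the open half-line: Schwartz functions on `ℝ` that vanish outside
`(0, ∞)`, with the topology induced by the Schwartz space of `ℝ`. -/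
def schwartzHalfLine : Submodule ℂ 𝓢(ℝ, ℂ) where
  carrier := {φ | ∀ x : ℝ, x ≤ 0 → φ x = 0}
  add_mem' := by
    intro φ ψ h1 h2 x hx
    simp [h1 x hx, h2 x hx]
  zero_mem' := by
    intro x _
    simp
  smul_mem' := by
    intro c φ h x hx
    simp [h x hx]

/-- Tempered distributions on the half-line. -/
abbrev TemperedHalfLine : Type := schwartzHalfLine →L[ℂ] ℂ

/-- `u = ∑ α i • a i` in the sense of distributions (weak convergence of the partial sums), where
the `a i` are `(p, ∞)`-atoms and `∑ |α i| ^ p < ∞`. -/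
def IsAtomicDecomposition (p : ℝ) (u : TemperedHalfLine) (α : ℕ → ℂ)
    (a : ℕ → HalfLine → ℂ) : Prop :=
  (∀ i, IsHardyAtom p (a i)) ∧ (Summable fun i => ‖α i‖ ^ p) ∧
    ∀ φ : schwartzHalfLine,
      Tendsto (fun n : ℕ => ∑ i ∈ Finset.range n, α i * ∫ x, a i x * (φ : 𝓢(ℝ, ℂ)) (x : ℝ))
        atTop (𝓝 (u φ))

theorem exists_isHardyAtom (p : ℝ) : ∃ a : HalfLine → ℂ, IsHardyAtom p a :=
  ⟨_, Or.inr ⟨1, one_pos, rfl⟩⟩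

theorem sum_range_interleave {M : Type*} [AddCommMonoid M] (f g : ℕ → M) (n : ℕ) :
    ∑ i ∈ Finset.range n, (if i % 2 = 0 then f (i / 2) else g (i / 2)) =
      ∑ i ∈ Finset.range ((n + 1) / 2), f i + ∑ i ∈ Finset.range (n / 2), g i := by
  induction n with
  | zero => simp
  | succ n ih =>
    rw [Finset.sum_range_succ, ih]
    rcases Nat.even_or_odd' n with ⟨k, rfl | rfl⟩
    · have h1 : (2 * k + 1) / 2 = k := by omega
      have h2 : (2 * k + 1 + 1) / 2 = k + 1 := by omega
      have h3 : 2 * k / 2 = k := by omega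
      have h4 : 2 * k % 2 = 0 := by omega
      rw [h1, h2, h3, if_pos h4, Finset.sum_range_succ]
      abel
    · have h1 : (2 * k + 1) / 2 = k := by omega
      have h2 : (2 * k + 1 + 1) / 2 = k + 1 := by omega
      have h3 : (2 * k + 1 + 1 + 1) / 2 = k + 1 := by omega
      have h4 : ¬ (2 * k + 1) % 2 = 0 := by omega
      rw [h1, h2, h3, if_neg h4, Finset.sum_range_succ g]
      abel

theorem tendsto_sum_range_interleave {M : Type*} [AddCommMonoid M] [TopologicalSpace M]
    [ContinuousAdd M] {f g : ℕ → M} {x y : M}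
    (hf : Tendsto (fun n : ℕ => ∑ i ∈ Finset.range n, f i) atTop (𝓝 x))
    (hg : Tendsto (fun n : ℕ => ∑ i ∈ Finset.range n, g i) atTop (𝓝 y)) :
    Tendsto (fun n : ℕ => ∑ i ∈ Finset.range n, (if i % 2 = 0 then f (i / 2) else g (i / 2)))
      atTop (𝓝 (x + y)) := by
  simp only [sum_range_interleave]
  refine Tendsto.add (hf.comp ?_) (hg.comp ?_)
  · exact tendsto_atTop_atTop.2 fun b => ⟨2 * b, fun a h => by omega⟩
  · exact tendsto_atTop_atTop.2 fun b => ⟨2 * b, fun a h => by omega⟩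

/-- The atomic Hardy space `H^p` of the half-line, a space of distributions. -/
def hardySpace (p : ℝ) (hp : 1 / 2 < p) : Submodule ℂ TemperedHalfLine where
  carrier := {u | ∃ α a, IsAtomicDecomposition p u α a}
  zero_mem' := by
    obtain ⟨a, ha⟩ := exists_isHardyAtom p
    refine ⟨fun _ => 0, fun _ => a, fun _ => ha, ?_, fun φ => ?_⟩
    · have : p ≠ 0 := by linarith
      simp [Real.zero_rpow this]
    · simp
  add_mem' := by
    rintro u v ⟨α, a, ha, hα, hu⟩ ⟨β, b, hb, hβ, hv⟩
    refine ⟨fun i => if i % 2 = 0 then α (i / 2) else β (i / 2),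
      fun i => if i % 2 = 0 then a (i / 2) else b (i / 2), fun i => ?_, ?_, fun φ => ?_⟩
    · dsimp only
      split_ifs
      · exact ha _
      · exact hb _
    · refine HasSum.summable (a := (∑' i, ‖α i‖ ^ p) + ∑' i, ‖β i‖ ^ p) ?_
      rw [hasSum_iff_tendsto_nat_of_nonneg (fun i => Real.rpow_nonneg (norm_nonneg _) p)]
      refine (tendsto_sum_range_interleave hα.hasSum.tendsto_sum_nat
        hβ.hasSum.tendsto_sum_nat).congr fun n => Finset.sum_congr rfl fun i _ => ?_
      split_ifs <;> rfl
    · refine (tendsto_sum_range_interleave (hu φ) (hv φ)).congr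
        fun n => Finset.sum_congr rfl fun i _ => ?_
      by_cases h : i % 2 = 0
      · simp only [if_pos h]
      · simp only [if_neg h]
  smul_mem' := by
    rintro c u ⟨α, a, ha, hα, hu⟩
    refine ⟨fun i => c * α i, a, ha, ?_, fun φ => ?_⟩
    · simpa [Real.mul_rpow] using hα.mul_left (‖c‖ ^ p)
    · simpa [Finset.mul_sum, mul_assoc] using (hu φ).const_mul c

/-- The quasi-norm of `H^p`: the infimum of `(∑ |α i| ^ p) ^ (1/p)` over all atomic
decompositions. -/
noncomputable def hardyNorm (p : ℝ) (u : TemperedHalfLine) : ℝ :=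
  sInf {r : ℝ | ∃ α a, IsAtomicDecomposition p u α a ∧ r = (∑' i, ‖α i‖ ^ p) ^ (1 / p)}

/-- The dual of `H^p`: the linear functionals that are bounded with respect to the quasi-norm. -/
def hardyDual (p : ℝ) (hp : 1 / 2 < p) : Set (hardySpace p hp →ₗ[ℂ] ℂ) :=
  {T | ∃ C : ℝ, ∀ u : hardySpace p hp, ‖T u‖ ≤ C * hardyNorm p u}

/-- Finite linear combinations of `(p, ∞)`-atoms, as functions. -/
def atomSpan (p : ℝ) : Submodule ℂ (HalfLine → ℂ) :=
  Submodule.span ℂ {a | IsHardyAtom p a}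

/-- The integrable functions on the half-line. -/
def integrableHalfLine : Submodule ℂ (HalfLine → ℂ) where
  carrier := {g | Integrable g volume}
  add_mem' h1 h2 := Integrable.add h1 h2
  zero_mem' := integrable_zero _ _ _
  smul_mem' c _ h := Integrable.smul c h

theorem integrable_mul_schwartz {g : HalfLine → ℂ} (hg : Integrable g) (φ : 𝓢(ℝ, ℂ)) :
    Integrable fun x : HalfLine => g x * φ (x : ℝ) := by
  refine hg.mul_bdd (c := SchwartzMap.seminorm ℝ 0 0 φ) ?_ ?_
  · exact (φ.continuous.comp continuous_subtype_val).aestronglyMeasurable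
  · exact Eventually.of_forall fun x => SchwartzMap.norm_le_seminorm ℝ φ x

/-- The distribution `φ ↦ ∫ g φ` defined by an integrable function `g`. -/
noncomputable def toDistribution : integrableHalfLine →ₗ[ℂ] TemperedHalfLine where
  toFun g :=
    (SchwartzMap.mkCLMtoNormedSpace (𝕜 := ℂ)
      (fun φ : 𝓢(ℝ, ℂ) => ∫ x : HalfLine, (g : HalfLine → ℂ) x * φ (x : ℝ))
      (fun φ ψ => by
        simp only [_root_.add_apply, mul_add]
        exact integral_add (integrable_mul_schwartz g.2 φ) (integrable_mul_schwartz g.2 ψ))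
      (fun c φ => by
        simp only [_root_.smul_apply, smul_eq_mul, mul_left_comm _ c, RingHom.id_apply]
        exact integral_const_mul _ _)
      (by
        refine ⟨{(0, 0)}, ∫ x, ‖(g : HalfLine → ℂ) x‖, integral_nonneg fun _ => norm_nonneg _,
          fun φ => ?_⟩
        rw [← integral_mul_const]
        refine norm_integral_le_of_norm_le (Integrable.mul_const (Integrable.norm g.2) _)
          (Eventually.of_forall fun x => ?_)
        rw [norm_mul]
        refine mul_le_mul_of_nonneg_left ?_ (norm_nonneg _)
        simpa using SchwartzMap.norm_le_seminorm ℂ φ (x : ℝ))).comp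
      schwartzHalfLine.subtypeL
  map_add' g h := by
    ext φ
    change ∫ x : HalfLine, ((g : HalfLine → ℂ) x + (h : HalfLine → ℂ) x) *
        (φ : 𝓢(ℝ, ℂ)) (x : ℝ) =
      (∫ x : HalfLine, (g : HalfLine → ℂ) x * (φ : 𝓢(ℝ, ℂ)) (x : ℝ)) +
        ∫ x : HalfLine, (h : HalfLine → ℂ) x * (φ : 𝓢(ℝ, ℂ)) (x : ℝ)
    simp only [add_mul]
    exact integral_add (integrable_mul_schwartz g.2 _) (integrable_mul_schwartz h.2 _)
  map_smul' c g := by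
    ext φ
    change ∫ x : HalfLine, (c * (g : HalfLine → ℂ) x) * (φ : 𝓢(ℝ, ℂ)) (x : ℝ) =
      c * ∫ x : HalfLine, (g : HalfLine → ℂ) x * (φ : 𝓢(ℝ, ℂ)) (x : ℝ)
    simp only [mul_assoc]
    exact integral_const_mul _ _

theorem toDistribution_apply (g : integrableHalfLine) (φ : schwartzHalfLine) :
    toDistribution g φ = ∫ x : HalfLine, (g : HalfLine → ℂ) x * (φ : 𝓢(ℝ, ℂ)) (x : ℝ) :=
  rfl

theorem volume_halfLine_lt_top (c : ℝ) :
    volume {x : HalfLine | (x : ℝ) ≤ c} < ⊤ := by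
  have h : MeasurableSet {x : HalfLine | (x : ℝ) ≤ c} :=
    measurableSet_le measurable_subtype_coe measurable_const
  change Measure.comap Subtype.val volume {x : HalfLine | (x : ℝ) ≤ c} < ⊤
  rw [(MeasurableEmbedding.subtype_coe measurableSet_Ioi).comap_apply]
  refine lt_of_le_of_lt (measure_mono ?_) (measure_Icc_lt_top (a := (0 : ℝ)) (b := c))
  rintro _ ⟨x, hx, rfl⟩
  exact ⟨le_of_lt x.2, hx⟩

theorem IsHardyAtom.integrable {p : ℝ} {a : HalfLine → ℂ} (ha : IsHardyAtom p a) : Integrable a := by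
  rcases ha with ⟨b, c, -, -, hm, hs, -, hn⟩ | ⟨b, -, rfl⟩
  · have h : MeasurableSet {x : HalfLine | (x : ℝ) ≤ c} :=
      measurableSet_le measurable_subtype_coe measurable_const
    have hL : MemLp a ⊤ volume :=
      ⟨hm.aestronglyMeasurable, lt_of_le_of_lt hn ENNReal.ofReal_lt_top⟩
    have : IsFiniteMeasure (volume.restrict {x : HalfLine | (x : ℝ) ≤ c}) :=
      ⟨by rw [Measure.restrict_apply_univ]; exact volume_halfLine_lt_top c⟩
    have hI : IntegrableOn a {x : HalfLine | (x : ℝ) ≤ c} :=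
      memLp_one_iff_integrable.1 ((hL.restrict _).mono_exponent le_top)
    refine (integrableOn_iff_integrable_of_support_subset fun x hx => ?_).1 hI
    by_contra hc
    exact hx (hs x fun h' => hc h'.2)
  · have h : MeasurableSet {x : HalfLine | (x : ℝ) < b} :=
      measurableSet_lt measurable_subtype_coe measurable_const
    refine IntegrableOn.integrable_indicator ?_ h
    refine integrableOn_const ?_
    have hsub : {x : HalfLine | (x : ℝ) < b} ⊆ {x : HalfLine | (x : ℝ) ≤ b} :=
      fun x hx => le_of_lt (show (x : ℝ) < b from hx)
    exact (lt_of_le_of_lt (measure_mono hsub) (volume_halfLine_lt_top b)).ne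

theorem atomSpan_le (p : ℝ) : atomSpan p ≤ integrableHalfLine :=
  Submodule.span_le.2 fun _ ha => IsHardyAtom.integrable ha

theorem toDistribution_mem_hardySpace (p : ℝ) (hp : 1 / 2 < p) (g : atomSpan p) :
    toDistribution (Submodule.inclusion (atomSpan_le p) g) ∈ hardySpace p hp := by
  have h : atomSpan p ≤
      ((hardySpace p hp).comap toDistribution).map integrableHalfLine.subtype := by
    refine Submodule.span_le.2 fun a ha => ?_
    refine ⟨⟨a, IsHardyAtom.integrable ha⟩, ?_, rfl⟩
    refine ⟨fun i => if i = 0 then 1 else 0, fun _ => a, fun _ => ha, ?_, fun φ => ?_⟩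
    · refine summable_of_ne_finset_zero (s := {0}) fun i hi => ?_
      have h0 : i ≠ 0 := by simpa using hi
      have : p ≠ 0 := by linarith
      simp [h0, Real.zero_rpow this]
    · refine tendsto_const_nhds.congr' ?_
      filter_upwards [eventually_gt_atTop 0] with n hn
      rw [toDistribution_apply]
      simp [hn.ne']
  obtain ⟨g', hg', he⟩ := h g.2
  have : Submodule.inclusion (atomSpan_le p) g = g' := Subtype.ext he.symm
  rw [this]
  exact hg'

/-- A finite linear combination of atoms, regarded as an element of `H^p`. -/
noncomputable def atomSpanToHardy (p : ℝ) (hp : 1 / 2 < p) :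
    atomSpan p →ₗ[ℂ] hardySpace p hp :=
  (toDistribution ∘ₗ Submodule.inclusion (atomSpan_le p)).codRestrict (hardySpace p hp)
    (toDistribution_mem_hardySpace p hp)

/-! Write `α = (1 - p) / p`, so that `1 / p = 1 + α`. From functionals to functions. A bounded `T`
is bounded on atoms, whose quasi-norm is at most 1. By scaling, it is at most `C * M * ℓ ^ (1 + α)`
on mean-zero functions of size `M` on an interval of length `ℓ`. Differences of normalised
indicators are such functions, so, as in Campanato's description of Hölder spaces, the "means"
`chiMean` over nested intervals differ by a multiple of (outer length)`^ α`
(`AtomBound.exists_chiMean_const`). They converge as intervals shrink to a point, and the limit `f`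
is Hölder; the atoms on `(0, b)` give its growth bound. That `T` is integration against `f` needs no
continuity beyond the bounds on atoms: the error on an interval is `O(ℓ ^ (1 + α))`, and bisecting
`n` times multiplies the total error bound by `2 ^ (-α n)` (`AtomBound.apply_eq_integral`).

From functions to functionals. Pairing `f` with an atom gives at most `K`, and `ℓ^p ⊆ ℓ^1`, so `∑ β
i * ∫ f * a i` converges. The issue is its independence of the decomposition, as `f` is not a test
function. It is approximated pointwise by Schwartz functions `φ n` satisfying the same bound `K`
(`HolderPlusBound.exists_schwartz_approx`); dominated convergence identifies the sum with the limit
of `u (φ n)`, which involves only `u` (`IsAtomicDecomposition.tendsto_apply`).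

Uniqueness of `f` follows by differentiating its integrals over `(0, b)`; uniqueness of `T` holds
because the tails of an atomic decomposition tend to zero in quasi-norm. -/

/-! ### Intervals, indicators and integrals on the half-line -/

/-- The trace on the half-line of the interval `[u, v)`. -/
def halfIco (u v : ℝ) : Set HalfLine := {x | u ≤ (x : ℝ) ∧ (x : ℝ) < v}

theorem measurableSet_halfIco (u v : ℝ) : MeasurableSet (halfIco u v) :=
  (measurableSet_le measurable_const measurable_subtype_coe).inter
    (measurableSet_lt measurable_subtype_coe measurable_const)

theorem volume_halfLine_apply (s : Set HalfLine) :
    volume s = volume (Subtype.val '' s : Set ℝ) :=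
  (MeasurableEmbedding.subtype_coe measurableSet_Ioi).comap_apply _ _

theorem volume_halfIco {u : ℝ} (hu : 0 ≤ u) (v : ℝ) :
    volume (halfIco u v) = ENNReal.ofReal (v - u) := by
  rw [volume_halfLine_apply]
  apply le_antisymm
  · rw [← Real.volume_Ico]
    refine measure_mono ?_
    rintro _ ⟨x, hx, rfl⟩
    exact hx
  · rw [← Real.volume_Ioo]
    refine measure_mono fun x hx => ?_
    exact ⟨⟨x, hu.trans_lt hx.1⟩, ⟨hx.1.le, hx.2⟩, rfl⟩

theorem volume_halfIcc_le (b c : ℝ) :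
    volume {x : HalfLine | (x : ℝ) ∈ Set.Icc b c} ≤ ENNReal.ofReal (c - b) := by
  rw [volume_halfLine_apply, ← Real.volume_Icc]
  refine measure_mono ?_
  rintro _ ⟨x, hx, rfl⟩
  exact hx

theorem integrable_of_support_Icc {g : HalfLine → ℂ} {b c M : ℝ}
    (hm : AEStronglyMeasurable g volume) (hs : ∀ x : HalfLine, (x : ℝ) ∉ Set.Icc b c → g x = 0)
    (hM : ∀ᵐ x : HalfLine, ‖g x‖ ≤ M) : Integrable g := by
  refine (integrableOn_iff_integrable_of_support_subset
    (s := {x : HalfLine | (x : ℝ) ∈ Set.Icc b c}) fun x hx => ?_).1 ?_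
  · by_contra hc
    exact hx (hs x hc)
  · exact Measure.integrableOn_of_bounded
      ((volume_halfIcc_le b c).trans_lt ENNReal.ofReal_lt_top).ne hm (ae_restrict_of_ae hM)

theorem norm_integral_le_of_support_Icc {g : HalfLine → ℂ} {b c M : ℝ} (hbc : b ≤ c) (hM0 : 0 ≤ M)
    (hs : ∀ x : HalfLine, (x : ℝ) ∉ Set.Icc b c → g x = 0)
    (hM : ∀ᵐ x : HalfLine, ‖g x‖ ≤ M) : ‖∫ x, g x‖ ≤ M * (c - b) := by
  rw [← setIntegral_eq_integral_of_forall_compl_eq_zero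
    (s := {x : HalfLine | (x : ℝ) ∈ Set.Icc b c}) fun x hx => hs x hx]
  refine (norm_setIntegral_le_of_norm_le_const_ae
    ((volume_halfIcc_le b c).trans_lt ENNReal.ofReal_lt_top)
    (ae_restrict_of_ae hM)).trans ?_
  refine mul_le_mul_of_nonneg_left ?_ hM0
  exact ENNReal.toReal_le_of_le_ofReal (sub_nonneg.2 hbc) (volume_halfIcc_le b c)

/-- The indicator function of `[u, v)`. -/
noncomputable def halfChi (u v : ℝ) : HalfLine → ℂ := (halfIco u v).indicator fun _ => 1

theorem halfChi_of_mem {u v : ℝ} {x : HalfLine} (h : x ∈ halfIco u v) : halfChi u v x = 1 :=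
  Set.indicator_of_mem h _

theorem halfChi_of_notMem {u v : ℝ} {x : HalfLine} (h : x ∉ halfIco u v) : halfChi u v x = 0 :=
  Set.indicator_of_notMem h _

theorem norm_halfChi_le (u v : ℝ) (x : HalfLine) : ‖halfChi u v x‖ ≤ 1 := by
  by_cases h : x ∈ halfIco u v
  · simp [halfChi_of_mem h]
  · simp [halfChi_of_notMem h]

theorem measurable_halfChi (u v : ℝ) : Measurable (halfChi u v) :=
  measurable_const.indicator (measurableSet_halfIco u v)

theorem support_Icc_of_support_halfIco {g : HalfLine → ℂ} {u v : ℝ}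
    (hs : ∀ x, x ∉ halfIco u v → g x = 0) (x : HalfLine) (hx : (x : ℝ) ∉ Set.Icc u v) : g x = 0 :=
  hs x fun h => hx ⟨h.1, h.2.le⟩

theorem integrable_halfChi (u v : ℝ) : Integrable (halfChi u v) :=
  integrable_of_support_Icc (measurable_halfChi u v).aestronglyMeasurable
    (support_Icc_of_support_halfIco fun _ h => halfChi_of_notMem h)
    (Eventually.of_forall (norm_halfChi_le u v))

theorem integral_halfChi {u v : ℝ} (hu : 0 ≤ u) (huv : u ≤ v) :
    ∫ x, halfChi u v x = ((v - u : ℝ) : ℂ) := by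
  have h := integral_indicator_const (μ := (volume : Measure HalfLine)) (1 : ℂ)
    (measurableSet_halfIco u v)
  rw [Measure.real, volume_halfIco hu, ENNReal.toReal_ofReal (sub_nonneg.2 huv)] at h
  exact h.trans (by simp)

/-! ### The Hölder space through one real constant -/

theorem continuous_of_norm_sub_le {X : Type*} [PseudoMetricSpace X] {f : X → ℂ} {K α : ℝ}
    (hα : 0 < α) (h : ∀ x y, ‖f x - f y‖ ≤ K * dist x y ^ α) : Continuous f := by
  refine continuous_iff_continuousAt.2 fun x => tendsto_iff_norm_sub_tendsto_zero.2 ?_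
  refine squeeze_zero (fun _ => norm_nonneg _) (fun y => h y x) ?_
  have : Tendsto (fun y => dist y x) (𝓝 x) (𝓝 0) := tendsto_iff_dist_tendsto_zero.1 tendsto_id
  simpa [Real.zero_rpow hα.ne'] using (this.rpow_const (Or.inr hα.le)).const_mul K

/-- Hölder continuity of order `α` with constant `K`, and growth at most `K x ^ α`. -/
structure HolderPlusBound (α K : ℝ) (f : HalfLine → ℂ) : Prop where
  nonneg : 0 ≤ K
  norm_sub_le : ∀ x y : HalfLine, ‖f x - f y‖ ≤ K * |(x : ℝ) - y| ^ α
  norm_le : ∀ x : HalfLine, ‖f x‖ ≤ K * (x : ℝ) ^ α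

theorem HolderPlusBound.continuous {α K : ℝ} (hα : 0 < α) {f : HalfLine → ℂ}
    (h : HolderPlusBound α K f) : Continuous f :=
  continuous_of_norm_sub_le hα h.norm_sub_le

theorem HolderPlusBound.memHolderPlus {α K : ℝ} (hα : 0 < α) {f : HalfLine → ℂ}
    (h : HolderPlusBound α K f) : MemHolderPlus α f := by
  refine ⟨h.continuous hα, ENNReal.add_lt_top.2 ⟨?_, ?_⟩⟩
  · refine lt_of_le_of_lt (iSup_le fun x => iSup_le fun y => iSup_le fun hxy => ?_)
      (ENNReal.ofReal_lt_top (r := K))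
    refine ENNReal.ofReal_le_ofReal ?_
    have : 0 < |(x : ℝ) - y| := abs_pos.2 (sub_ne_zero.2 fun h => hxy (Subtype.ext h))
    exact (div_le_iff₀ (Real.rpow_pos_of_pos this α)).2 (h.norm_sub_le x y)
  · refine lt_of_le_of_lt (iSup_le fun x => ?_) (ENNReal.ofReal_lt_top (r := K))
    refine ENNReal.ofReal_le_ofReal ?_
    have hx : (0 : ℝ) < x := x.2
    rw [Real.rpow_neg hx.le, inv_mul_le_iff₀ (Real.rpow_pos_of_pos hx α), mul_comm]
    exact h.norm_le x

theorem MemHolderPlus.exists_bound {α : ℝ} (hα : 0 < α) {f : HalfLine → ℂ}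
    (h : MemHolderPlus α f) : ∃ K, HolderPlusBound α K f := by
  have hle : ∀ t : ℝ, ENNReal.ofReal t ≤ holderPlusNorm α f → t ≤ (holderPlusNorm α f).toReal :=
    fun t ht => (ENNReal.ofReal_le_iff_le_toReal h.2.ne).1 ht
  refine ⟨(holderPlusNorm α f).toReal, ENNReal.toReal_nonneg, fun x y => ?_, fun x => ?_⟩
  · by_cases hxy : x = y
    · simp [hxy, Real.zero_rpow hα.ne']
    · have : 0 < |(x : ℝ) - y| := abs_pos.2 (sub_ne_zero.2 fun h => hxy (Subtype.ext h))
      refine (div_le_iff₀ (Real.rpow_pos_of_pos this α)).1 (hle _ ?_)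
      refine le_trans ?_ le_self_add
      exact le_iSup_of_le x (le_iSup_of_le y (le_iSup_of_le hxy le_rfl))
  · have hx : (0 : ℝ) < x := x.2
    have := hle ((x : ℝ) ^ (-α) * ‖f x‖) (le_trans
      (le_iSup (fun x : HalfLine => ENNReal.ofReal ((x : ℝ) ^ (-α) * ‖f x‖)) x) le_add_self)
    rwa [Real.rpow_neg hx.le, inv_mul_le_iff₀ (Real.rpow_pos_of_pos hx α), mul_comm] at this

/-! ### The Hölder function of a functional bounded on atoms -/

/-- A linear functional on functions which is bounded on multiples of atoms. -/
structure AtomBound (α C : ℝ) (L : (HalfLine → ℂ) →ₗ[ℂ] ℂ) : Prop where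
  nonneg : 0 ≤ C
  cancel : ∀ (u v M : ℝ) (g : HalfLine → ℂ), 0 ≤ u → u < v → 0 < M → Measurable g →
    (∀ x, x ∉ halfIco u v → g x = 0) → ∫ x, g x = 0 → (∀ᵐ x : HalfLine, ‖g x‖ ≤ M) →
    ‖L g‖ ≤ C * M * (v - u) ^ (1 + α)
  chi : ∀ v : ℝ, 0 < v → ‖L (halfChi 0 v)‖ ≤ C * v ^ (1 + α)

/-- The mean over `[u, v)` of the function represented by `L`. -/
noncomputable def chiMean (L : (HalfLine → ℂ) →ₗ[ℂ] ℂ) (u v : ℝ) : ℂ :=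
  L (halfChi u v) / ((v - u : ℝ) : ℂ)

theorem chiMean_mul (L : (HalfLine → ℂ) →ₗ[ℂ] ℂ) {u v : ℝ} (huv : u < v) :
    chiMean L u v * ((v - u : ℝ) : ℂ) = L (halfChi u v) :=
  div_mul_cancel₀ _ (Complex.ofReal_ne_zero.2 (sub_pos.2 huv).ne')

/-- The difference of the two normalised indicators has mean zero and lives on the outer interval.
Both heights are at most `1 / (v - u)`, whence the factor `2 / (v - u)`. -/
theorem AtomBound.norm_chiMean_sub_le {α C : ℝ} {L : (HalfLine → ℂ) →ₗ[ℂ] ℂ}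
    (h : AtomBound α C L) {U u v V : ℝ} (hU : 0 ≤ U) (hUu : U ≤ u) (huv : u < v) (hvV : v ≤ V) :
    ‖chiMean L u v - chiMean L U V‖ ≤ C * (2 / (v - u)) * (V - U) ^ (1 + α) := by
  have h1 : 0 < v - u := sub_pos.2 huv
  have h2 : 0 < V - U := by linarith
  set g : HalfLine → ℂ := (((v - u : ℝ) : ℂ)⁻¹) • halfChi u v - (((V - U : ℝ) : ℂ)⁻¹) • halfChi U V
    with hg
  have hL : L g = chiMean L u v - chiMean L U V := by
    simp only [hg, map_sub, map_smul, smul_eq_mul, chiMean, div_eq_inv_mul]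
  rw [← hL]
  refine h.cancel U V _ g hU (by linarith) (by positivity) ?_ ?_ ?_ ?_
  · exact ((measurable_halfChi u v).const_smul _).sub ((measurable_halfChi U V).const_smul _)
  · intro x hx
    have hx' : x ∉ halfIco u v := fun hx' => hx ⟨hUu.trans hx'.1, hx'.2.trans_le hvV⟩
    simp [hg, halfChi_of_notMem hx, halfChi_of_notMem hx']
  · have : ∫ x, g x = ∫ x, (((v - u : ℝ) : ℂ)⁻¹ * halfChi u v x -
        ((V - U : ℝ) : ℂ)⁻¹ * halfChi U V x) := rfl
    rw [this, integral_sub ((integrable_halfChi u v).const_mul _)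
      ((integrable_halfChi U V).const_mul _), integral_const_mul, integral_const_mul,
      integral_halfChi (hU.trans hUu) huv.le, integral_halfChi hU (by linarith),
      inv_mul_cancel₀ (Complex.ofReal_ne_zero.2 h1.ne'),
      inv_mul_cancel₀ (Complex.ofReal_ne_zero.2 h2.ne'), sub_self]
  · refine Eventually.of_forall fun x => ?_
    have e1 : ‖((v - u : ℝ) : ℂ)⁻¹‖ = (v - u)⁻¹ := by
      rw [norm_inv, Complex.norm_real, Real.norm_of_nonneg h1.le]
    have e2 : ‖((V - U : ℝ) : ℂ)⁻¹‖ ≤ (v - u)⁻¹ := by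
      rw [norm_inv, Complex.norm_real, Real.norm_of_nonneg h2.le]
      exact inv_anti₀ h1 (by linarith)
    refine (norm_sub_le _ _).trans ?_
    simp only [Pi.smul_apply, smul_eq_mul, norm_mul]
    have := mul_le_mul e1.le (norm_halfChi_le u v x) (norm_nonneg _) (by positivity)
    have := mul_le_mul e2 (norm_halfChi_le U V x) (norm_nonneg _) (by positivity)
    rw [div_eq_mul_inv]
    linarith

/-- The direct comparison degenerates when the inner interval is short. Passing through a chain of
intervals that halve in length gives a geometric series of ratio `2 ^ (-α)`, so the constant no
longer depends on the ratio of lengths. -/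
theorem AtomBound.exists_chiMean_const {α C : ℝ} (hα : 0 < α) {L : (HalfLine → ℂ) →ₗ[ℂ] ℂ}
    (h : AtomBound α C L) : ∃ K : ℝ, 0 ≤ K ∧ ∀ U u v V : ℝ, 0 ≤ U → U ≤ u → u < v → v ≤ V →
      ‖chiMean L u v - chiMean L U V‖ ≤ K * (V - U) ^ α := by
  have hq1 : (2 : ℝ) ^ (-α) < 1 := Real.rpow_lt_one_of_one_lt_of_neg one_lt_two (by linarith)
  have hq0 : (0 : ℝ) < 2 ^ (-α) := by positivity
  have hC := h.nonneg
  set q : ℝ := 2 ^ (-α) with hq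
  -- The sum of the geometric series, i.e. the fixed point of `K ↦ K * q + 4 * C`, which is one
  -- halving step.
  set K : ℝ := 4 * C / (1 - q) with hKdef
  have hK0 : 0 ≤ K := div_nonneg (by linarith) (by linarith)
  have hK : K * q + 4 * C = K := by
    have : K * (1 - q) = 4 * C := div_mul_cancel₀ _ (by linarith)
    linarith
  have hdirect : ∀ U u v V : ℝ, 0 ≤ U → U ≤ u → u < v → v ≤ V → V - U ≤ 2 * (v - u) →
      ‖chiMean L u v - chiMean L U V‖ ≤ 4 * C * (V - U) ^ α := by
    intro U u v V hU hUu huv hvV hs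
    refine (h.norm_chiMean_sub_le hU hUu huv hvV).trans ?_
    have h1 : 0 < v - u := sub_pos.2 huv
    have h2 : 0 < V - U := by linarith
    rw [Real.rpow_add h2, Real.rpow_one]
    have h3 : 2 / (v - u) * (V - U) ≤ 4 := by
      rw [div_mul_eq_mul_div, div_le_iff₀ h1]
      linarith
    have h4 : 0 ≤ C * (V - U) ^ α := by positivity
    calc _ = C * (V - U) ^ α * (2 / (v - u) * (V - U)) := by ring
      _ ≤ C * (V - U) ^ α * 4 := mul_le_mul_of_nonneg_left h3 h4
      _ = _ := by ring
  have key : ∀ n : ℕ, ∀ U u v V : ℝ, 0 ≤ U → U ≤ u → u < v → v ≤ V →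
      V - U ≤ 2 ^ n * (v - u) → ‖chiMean L u v - chiMean L U V‖ ≤ K * (V - U) ^ α := by
    have hmono : ∀ t : ℝ, 0 ≤ t → 4 * C * t ^ α ≤ K * t ^ α := fun t ht => by
      refine mul_le_mul_of_nonneg_right ?_ (Real.rpow_nonneg ht _)
      nlinarith [mul_nonneg hK0 hq0.le]
    intro n
    induction n with
    | zero =>
      intro U u v V hU hUu huv hvV hs
      refine (hdirect U u v V hU hUu huv hvV ?_).trans (hmono _ (by linarith))
      rw [pow_zero, one_mul] at hs
      linarith
    | succ n ih =>
      intro U u v V hU hUu huv hvV hs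
      by_cases hc : V - U ≤ 2 * (v - u)
      · exact (hdirect U u v V hU hUu huv hvV hc).trans (hmono _ (by linarith))
      push Not at hc
      set l := (V - U) / 2 with hl
      have hl0 : 0 < l := by linarith
      -- The interval `[U', U' + l)` has half the outer length, contains `[u, v)` and stays inside
      -- `[U, V)`.
      set U' := max U (v - l) with hU'
      have a1 : U ≤ U' := le_max_left _ _
      have a2 : v - l ≤ U' := le_max_right _ _
      have a3 : U' ≤ u := max_le hUu (by linarith)
      have a4 : U' + l ≤ V := by
        have : U' ≤ V - l := max_le (by linarith) (by linarith)
        linarith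
      have b1 := ih U' u v (U' + l) (hU.trans a1) a3 huv (by linarith)
        (by rw [pow_succ] at hs; linarith)
      have b2 := hdirect U U' (U' + l) V hU a1 (by linarith) a4 (by linarith)
      have b3 : (U' + l - U') ^ α = q * (V - U) ^ α := by
        rw [add_sub_cancel_left, hl, Real.div_rpow (by linarith) zero_le_two, hq,
          Real.rpow_neg zero_le_two]
        ring
      rw [b3] at b1
      calc _ ≤ _ := norm_sub_le_norm_sub_add_norm_sub _ (chiMean L U' (U' + l)) _
        _ ≤ K * (q * (V - U) ^ α) + 4 * C * (V - U) ^ α := add_le_add b1 b2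
        _ = (K * q + 4 * C) * (V - U) ^ α := by ring
        _ = _ := by rw [hK]
  refine ⟨K, hK0, fun U u v V hU hUu huv hvV => ?_⟩
  have h1 : 0 < v - u := sub_pos.2 huv
  obtain ⟨n, hn⟩ := pow_unbounded_of_one_lt ((V - U) / (v - u)) one_lt_two
  exact key n U u v V hU hUu huv hvV ((div_lt_iff₀ h1).1 hn).le

/-- The value `f x` is the limit of means over `[x, x + 1 / (n + 1))`. With half-open intervals, `x
∈ [u, v)` forces these to lie in `[u, v)` eventually, even when `x = u`, so the nested comparison
passes to the limit. -/
theorem AtomBound.exists_limit {α C : ℝ} (hα : 0 < α) {L : (HalfLine → ℂ) →ₗ[ℂ] ℂ}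
    (h : AtomBound α C L) : ∃ (K : ℝ) (f : HalfLine → ℂ), 0 ≤ K ∧
      ∀ u v : ℝ, 0 ≤ u → ∀ x : HalfLine, x ∈ halfIco u v →
        ‖chiMean L u v - f x‖ ≤ K * (v - u) ^ α := by
  obtain ⟨K, hK0, hK⟩ := h.exists_chiMean_const hα
  have hlim : ∀ x : HalfLine, ∃ z : ℂ,
      Tendsto (fun n : ℕ => chiMean L x ((x : ℝ) + 1 / ((n : ℝ) + 1))) atTop (𝓝 z) := by
    intro x
    have hx : (0 : ℝ) < x := x.2
    refine cauchySeq_tendsto_of_complete ?_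
    refine cauchySeq_of_le_tendsto_0 (fun N : ℕ => K * (1 / ((N : ℝ) + 1)) ^ α +
      K * (1 / ((N : ℝ) + 1)) ^ α) ?_ ?_
    · intro n m N hn hm
      have hcomp : ∀ n : ℕ, N ≤ n → ‖chiMean L x ((x : ℝ) + 1 / ((n : ℝ) + 1)) -
          chiMean L x ((x : ℝ) + 1 / ((N : ℝ) + 1))‖ ≤ K * (1 / ((N : ℝ) + 1)) ^ α := by
        intro n hn
        have h1 : 1 / ((n : ℝ) + 1) ≤ 1 / ((N : ℝ) + 1) := Nat.one_div_le_one_div hn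
        have h2 : 0 < 1 / ((n : ℝ) + 1) := Nat.one_div_pos_of_nat
        have := hK x x ((x : ℝ) + 1 / ((n : ℝ) + 1)) ((x : ℝ) + 1 / ((N : ℝ) + 1)) hx.le le_rfl
          (by linarith) (by linarith)
        rwa [add_sub_cancel_left] at this
      refine (dist_triangle_right _ _
        (chiMean L x ((x : ℝ) + 1 / ((N : ℝ) + 1)))).trans (add_le_add ?_ ?_)
      · rw [dist_eq_norm]; exact hcomp n hn
      · rw [dist_eq_norm]; exact hcomp m hm
    · have := ((tendsto_one_div_add_atTop_nhds_zero_nat (𝕜 := ℝ)).rpow_const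
        (p := α) (Or.inr hα.le)).const_mul K
      rw [Real.zero_rpow hα.ne', mul_zero] at this
      simpa using this.add this
  choose f hf using hlim
  refine ⟨K, f, hK0, fun u v hu x hx => ?_⟩
  have ht : Tendsto (fun n : ℕ => ‖chiMean L u v - chiMean L x ((x : ℝ) + 1 / ((n : ℝ) + 1))‖)
      atTop (𝓝 ‖chiMean L u v - f x‖) := (tendsto_const_nhds.sub (hf x)).norm
  refine le_of_tendsto ht ?_
  have hev := (tendsto_one_div_add_atTop_nhds_zero_nat (𝕜 := ℝ)).eventually
    (gt_mem_nhds (sub_pos.2 hx.2))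
  filter_upwards [hev] with n hn
  have h2 : 0 < 1 / ((n : ℝ) + 1) := Nat.one_div_pos_of_nat
  rw [norm_sub_rev]
  exact hK u x _ v hu hx.1 (by linarith) (by linarith)

theorem AtomBound.holderPlusBound {α C K : ℝ} {L : (HalfLine → ℂ) →ₗ[ℂ] ℂ}
    (h : AtomBound α C L) {f : HalfLine → ℂ} (hK0 : 0 ≤ K)
    (hK : ∀ u v : ℝ, 0 ≤ u → ∀ x : HalfLine, x ∈ halfIco u v →
      ‖chiMean L u v - f x‖ ≤ K * (v - u) ^ α) :
    HolderPlusBound α (2 * (C + K) * 2 ^ α) f := by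
  have hC := h.nonneg
  have h2 : (0 : ℝ) < 2 ^ α := by positivity
  have hlt : ∀ x y : HalfLine, (x : ℝ) < y →
      ‖f x - f y‖ ≤ 2 * (C + K) * 2 ^ α * |(x : ℝ) - y| ^ α := by
    intro x y hxy
    have hx : (0 : ℝ) < x := x.2
    -- An interval of length `2 * |x - y|` is used because `y` must belong to it, and `[x, y)` omits
    -- its right end.
    have h1 := hK x (2 * y - x) hx.le x ⟨le_rfl, by linarith⟩
    have h3 := hK x (2 * y - x) hx.le y ⟨hxy.le, by linarith⟩
    have e : (2 * (y : ℝ) - x - x) ^ α = 2 ^ α * |(x : ℝ) - y| ^ α := by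
      rw [abs_sub_comm, abs_of_pos (sub_pos.2 hxy), ← Real.mul_rpow zero_le_two (by linarith)]
      congr 1; ring
    rw [e] at h1 h3
    rw [norm_sub_rev] at h1
    have h4 := norm_sub_le_norm_sub_add_norm_sub (f x) (chiMean L x (2 * y - x)) (f y)
    have h5 : 0 ≤ C * (2 ^ α * |(x : ℝ) - y| ^ α) := by positivity
    linarith
  refine ⟨by positivity, fun x y => ?_, fun x => ?_⟩
  · rcases lt_trichotomy (x : ℝ) y with hxy | hxy | hxy
    · exact hlt x y hxy
    · rw [Subtype.ext hxy, sub_self, norm_zero]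
      positivity
    · rw [norm_sub_rev, abs_sub_comm]
      exact hlt y x hxy
  · have hx : (0 : ℝ) < x := x.2
    -- Growth comes from comparing `f x` with the mean over `[0, 2x)`, which the non-cancelling
    -- atoms control.
    have h1 := hK 0 (2 * x) le_rfl x ⟨hx.le, by linarith⟩
    have h3 : ‖chiMean L 0 (2 * x)‖ ≤ C * (2 * x) ^ α := by
      have h2x : 0 < 2 * (x : ℝ) := by linarith
      rw [chiMean, norm_div, sub_zero, Complex.norm_real, Real.norm_of_nonneg h2x.le,
        div_le_iff₀ h2x]
      refine (h.chi _ h2x).trans_eq ?_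
      rw [Real.rpow_add h2x, Real.rpow_one]
      ring
    rw [sub_zero] at h1
    rw [Real.mul_rpow zero_le_two hx.le] at h1 h3
    have h4 : ‖f x‖ ≤ ‖chiMean L 0 (2 * x)‖ + ‖chiMean L 0 (2 * x) - f x‖ := by
      rw [norm_sub_rev]; exact norm_le_norm_add_norm_sub' _ _
    have h5 : 0 ≤ C * (2 ^ α * (x : ℝ) ^ α) := by positivity
    have h6 : 0 ≤ K * (2 ^ α * (x : ℝ) ^ α) := by positivity
    linarith

/-! ### Integral representation on bounded functions of bounded support -/

theorem HolderPlusBound.norm_mul_le {α K v : ℝ} (hα : 0 < α) {f g : HalfLine → ℂ}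
    (hf : HolderPlusBound α K f) (hs : ∀ x : HalfLine, v < x → g x = 0) (x : HalfLine) :
    ‖f x * g x‖ ≤ K * |v| ^ α * ‖g x‖ := by
  rw [norm_mul]
  by_cases hx : v < x
  · simp [hs x hx]
  · have hx0 : (0 : ℝ) < x := x.2
    refine mul_le_mul_of_nonneg_right ((hf.norm_le x).trans ?_) (norm_nonneg _)
    refine mul_le_mul_of_nonneg_left ?_ hf.nonneg
    exact Real.rpow_le_rpow hx0.le ((not_lt.1 hx).trans (le_abs_self v)) hα.le

theorem HolderPlusBound.integrable_mul {α K v : ℝ} (hα : 0 < α) {f g : HalfLine → ℂ}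
    (hf : HolderPlusBound α K f) (hg : Integrable g) (hs : ∀ x : HalfLine, v < x → g x = 0) :
    Integrable fun x => f x * g x :=
  Integrable.mono' (g := fun x => K * |v| ^ α * ‖g x‖) (hg.norm.const_mul _)
    ((hf.continuous hα).aestronglyMeasurable.mul hg.aestronglyMeasurable)
    (Eventually.of_forall (hf.norm_mul_le hα hs))

/-- Both `L g` and `∫ f * g` are close to `m * ∫ g`, where `m` is the mean over the interval:
removing the constant part of `g` leaves a mean-zero function of size `2 * M`, and `f` stays within
`K * (v - u) ^ α` of `m`. -/
theorem AtomBound.norm_sub_integral_le {α C K B : ℝ} (hα : 0 < α) {L : (HalfLine → ℂ) →ₗ[ℂ] ℂ}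
    (h : AtomBound α C L) {f : HalfLine → ℂ} (hK0 : 0 ≤ K)
    (hK : ∀ u v : ℝ, 0 ≤ u → ∀ x : HalfLine, x ∈ halfIco u v →
      ‖chiMean L u v - f x‖ ≤ K * (v - u) ^ α) (hf : HolderPlusBound α B f)
    {u v M : ℝ} {g : HalfLine → ℂ} (hu : 0 ≤ u) (huv : u < v) (hM0 : 0 < M) (hm : Measurable g)
    (hs : ∀ x, x ∉ halfIco u v → g x = 0) (hM : ∀ᵐ x : HalfLine, ‖g x‖ ≤ M) :
    ‖L g - ∫ x, f x * g x‖ ≤ (2 * C + K) * M * (v - u) ^ (1 + α) := by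
  have h1 : 0 < v - u := sub_pos.2 huv
  have h1' : ((v - u : ℝ) : ℂ) ≠ 0 := Complex.ofReal_ne_zero.2 h1.ne'
  have hs' := support_Icc_of_support_halfIco hs
  have hgi : Integrable g := integrable_of_support_Icc hm.aestronglyMeasurable hs' hM
  have hfg : Integrable fun x => f x * g x :=
    hf.integrable_mul (v := v) hα hgi fun x hx => hs' x fun hx' => not_le.2 hx hx'.2
  set m := chiMean L u v with hmdef
  set c : ℂ := (∫ x, g x) / ((v - u : ℝ) : ℂ) with hc
  have hcM : ‖c‖ ≤ M := by
    rw [hc, norm_div, Complex.norm_real, Real.norm_of_nonneg h1.le, div_le_iff₀ h1]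
    exact norm_integral_le_of_support_Icc huv.le hM0.le hs' hM
  have hcI : c * ((v - u : ℝ) : ℂ) = ∫ x, g x := div_mul_cancel₀ _ h1'
  have hL : L g = L (g - c • halfChi u v) + m * ∫ x, g x := by
    rw [map_sub, map_smul, smul_eq_mul, ← hcI, ← chiMean_mul L huv]
    ring
  have hI : ∫ x, f x * g x = (∫ x, (f x - m) * g x) + m * ∫ x, g x := by
    rw [← integral_const_mul, ← integral_add]
    · congr 1; ext x; ring
    · refine (hfg.sub (hgi.const_mul m)).congr (Eventually.of_forall fun x => ?_)
      simp only [Pi.sub_apply]; ring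
    · exact hgi.const_mul m
  have e1 : ‖L (g - c • halfChi u v)‖ ≤ C * (2 * M) * (v - u) ^ (1 + α) := by
    refine h.cancel u v _ _ hu huv (by linarith) (hm.sub ((measurable_halfChi u v).const_smul c))
      (fun x hx => by simp [hs x hx, halfChi_of_notMem hx]) ?_ ?_
    · have : ∫ x, (g - c • halfChi u v) x = ∫ x, (g x - c * halfChi u v x) := rfl
      rw [this, integral_sub hgi ((integrable_halfChi u v).const_mul c), integral_const_mul,
        integral_halfChi hu huv.le, hcI, sub_self]
    · filter_upwards [hM] with x hx
      refine (norm_sub_le _ _).trans ?_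
      simp only [Pi.smul_apply, smul_eq_mul, norm_mul]
      have := mul_le_mul hcM (norm_halfChi_le u v x) (norm_nonneg _) hM0.le
      linarith
  have e2 : ‖∫ x, (f x - m) * g x‖ ≤ K * (v - u) ^ α * M * (v - u) := by
    refine norm_integral_le_of_support_Icc huv.le (by positivity)
      (fun x hx => by rw [hs' x hx, mul_zero]) ?_
    filter_upwards [hM] with x hx
    rw [norm_mul]
    by_cases hxI : x ∈ halfIco u v
    · refine mul_le_mul ?_ hx (norm_nonneg _) (by positivity)
      rw [norm_sub_rev]
      exact hK u v hu x hxI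
    · rw [hs x hxI, norm_zero, mul_zero]
      positivity
  have e3 : (v - u) ^ (1 + α) = (v - u) * (v - u) ^ α := by
    rw [Real.rpow_add h1, Real.rpow_one]
  rw [hL, hI, add_sub_add_right_eq_sub]
  refine (norm_sub_le _ _).trans ((add_le_add e1 e2).trans_eq ?_)
  rw [e3]
  ring

/-- The error is additive in `g`, while its bound is superlinear in the length. Each bisection
therefore gains a factor `q = 2 ^ (-α)`, and the error must vanish. -/
theorem AtomBound.apply_eq_integral {α C K B : ℝ} (hα : 0 < α) {L : (HalfLine → ℂ) →ₗ[ℂ] ℂ}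
    (h : AtomBound α C L) {f : HalfLine → ℂ} (hK0 : 0 ≤ K)
    (hK : ∀ u v : ℝ, 0 ≤ u → ∀ x : HalfLine, x ∈ halfIco u v →
      ‖chiMean L u v - f x‖ ≤ K * (v - u) ^ α) (hf : HolderPlusBound α B f)
    {u v M : ℝ} {g : HalfLine → ℂ} (hu : 0 ≤ u) (huv : u < v) (hM0 : 0 < M) (hm : Measurable g)
    (hs : ∀ x, x ∉ halfIco u v → g x = 0) (hM : ∀ᵐ x : HalfLine, ‖g x‖ ≤ M) :
    L g = ∫ x, f x * g x := by
  set q : ℝ := 2 ^ (-α) with hq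
  have hq0 : 0 < q := by positivity
  have hq1 : q < 1 := Real.rpow_lt_one_of_one_lt_of_neg one_lt_two (by linarith)
  have key : ∀ n : ℕ, ∀ (u v : ℝ) (g : HalfLine → ℂ), 0 ≤ u → u < v → Measurable g →
      (∀ x, x ∉ halfIco u v → g x = 0) → (∀ᵐ x : HalfLine, ‖g x‖ ≤ M) →
      ‖L g - ∫ x, f x * g x‖ ≤ (2 * C + K) * M * (v - u) ^ (1 + α) * q ^ n := by
    intro n
    induction n with
    | zero =>
      intro u v g hu huv hm hs hM
      rw [pow_zero, mul_one]
      exact h.norm_sub_integral_le hα hK0 hK hf hu huv hM0 hm hs hM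
    | succ n ih =>
      intro u v g hu huv hm hs hM
      set w := (u + v) / 2 with hw
      have huw : u < w := by linarith
      have hwv : w < v := by linarith
      set g1 := (halfIco u w).indicator g with hg1
      set g2 := (halfIco w v).indicator g with hg2
      have hg : g = g1 + g2 := by
        ext x
        by_cases hx1 : x ∈ halfIco u w
        · have hx2 : x ∉ halfIco w v := fun hx => not_lt.2 hx.1 hx1.2
          simp [hg1, hg2, hx1, hx2]
        · by_cases hx2 : x ∈ halfIco w v
          · simp [hg1, hg2, hx1, hx2]
          · have : x ∉ halfIco u v := fun hx => by
              rcases lt_or_ge (x : ℝ) w with hxw | hxw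
              · exact hx1 ⟨hx.1, hxw⟩
              · exact hx2 ⟨hxw, hx.2⟩
            simp [hg1, hg2, hx1, hx2, hs x this]
      have hb : ∀ s : Set HalfLine, ∀ᵐ x : HalfLine, ‖s.indicator g x‖ ≤ M := fun s => by
        filter_upwards [hM] with x hx using (norm_indicator_le_norm_self g x).trans hx
      have hm1 : Measurable g1 := hm.indicator (measurableSet_halfIco u w)
      have hm2 : Measurable g2 := hm.indicator (measurableSet_halfIco w v)
      have hs1 : ∀ x, x ∉ halfIco u w → g1 x = 0 := fun x hx => Set.indicator_of_notMem hx g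
      have hs2 : ∀ x, x ∉ halfIco w v → g2 x = 0 := fun x hx => Set.indicator_of_notMem hx g
      have hint : ∀ (a b : ℝ) (k : HalfLine → ℂ), Measurable k → (∀ x, x ∉ halfIco a b → k x = 0) →
          (∀ᵐ x : HalfLine, ‖k x‖ ≤ M) → Integrable fun x => f x * k x := by
        intro a b k hk hsk hMk
        have hsk' := support_Icc_of_support_halfIco hsk
        exact hf.integrable_mul (v := b) hα
          (integrable_of_support_Icc hk.aestronglyMeasurable hsk' hMk)
          fun x hx => hsk' x fun hx' => not_le.2 hx hx'.2
      have hI : ∫ x, f x * g x = (∫ x, f x * g1 x) + ∫ x, f x * g2 x := by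
        rw [← integral_add (hint _ _ _ hm1 hs1 (hb _)) (hint _ _ _ hm2 hs2 (hb _))]
        refine integral_congr_ae (Eventually.of_forall fun x => ?_)
        simp only [hg, Pi.add_apply, mul_add]
      have hLg : L g = L g1 + L g2 := by rw [← map_add, ← hg]
      have i1 := ih u w g1 hu huw hm1 hs1 (hb _)
      have i2 := ih w v g2 (hu.trans huw.le) hwv hm2 hs2 (hb _)
      have e1 : w - u = (v - u) / 2 := by rw [hw]; ring
      have e2 : v - w = (v - u) / 2 := by rw [hw]; ring
      have e3 : ((v - u) / 2) ^ (1 + α) = (v - u) ^ (1 + α) * q / 2 := by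
        rw [Real.div_rpow (by linarith) zero_le_two, Real.rpow_add two_pos, Real.rpow_one, hq,
          Real.rpow_neg zero_le_two]
        field_simp
      rw [e1, e3] at i1
      rw [e2, e3] at i2
      rw [hLg, hI, add_sub_add_comm]
      refine (norm_add_le _ _).trans ((add_le_add i1 i2).trans_eq ?_)
      ring
  have hlim : Tendsto (fun n : ℕ => (2 * C + K) * M * (v - u) ^ (1 + α) * q ^ n) atTop (𝓝 0) := by
    simpa using (tendsto_pow_atTop_nhds_zero_of_lt_one hq0.le hq1).const_mul
      ((2 * C + K) * M * (v - u) ^ (1 + α))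
  have := ge_of_tendsto' hlim fun n => key n u v g hu huv hm hs hM
  exact sub_eq_zero.1 (norm_le_zero_iff.1 this)

theorem IsHardyAtom.exists_support {p : ℝ} {a : HalfLine → ℂ} (ha : IsHardyAtom p a) :
    ∃ u v M : ℝ, 0 ≤ u ∧ u < v ∧ 0 < M ∧ Measurable a ∧ (∀ x, x ∉ halfIco u v → a x = 0) ∧
      ∀ᵐ x : HalfLine, ‖a x‖ ≤ M := by
  rcases ha with ⟨b, c, hb, hbc, hm, hs, -, hn⟩ | ⟨b, hb, rfl⟩
  · have hcb : 0 < (c - b) ^ (-1 / p) := Real.rpow_pos_of_pos (sub_pos.2 hbc) _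
    -- Atoms are supported in closed intervals; enlarging `c` makes room for the right endpoint in a
    -- half-open one.
    refine ⟨b, c + 1, (c - b) ^ (-1 / p), hb, by linarith, hcb, hm, fun x hx => ?_, ?_⟩
    · exact hs x fun hx' => hx ⟨hx'.1, by linarith [hx'.2]⟩
    · filter_upwards [ae_le_eLpNormEssSup (f := a) (μ := volume)] with x hx
      rw [eLpNorm_exponent_top] at hn
      have := hx.trans hn
      rwa [← ofReal_norm, ENNReal.ofReal_le_ofReal_iff hcb.le] at this
  · have hb' : 0 < b ^ (-1 / p) := Real.rpow_pos_of_pos hb _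
    refine ⟨0, b, b ^ (-1 / p), le_rfl, hb, hb', measurable_const.indicator
      (measurableSet_lt measurable_subtype_coe measurable_const), fun x hx => ?_,
      Eventually.of_forall fun x => (norm_indicator_le_norm_self _ _).trans_eq ?_⟩
    · have hxb : ¬ (x : ℝ) < b := fun hx' => hx ⟨le_of_lt x.2, hx'⟩
      simp [Set.indicator, hxb]
    · rw [Complex.norm_real, Real.norm_of_nonneg hb'.le]

/-- A linear functional on functions which is bounded on atoms is integration against a Hölder
function. -/
theorem exists_holderPlusBound_of_bounded_on_atoms {p C : ℝ} (hp0 : 0 < p) (hp1 : p < 1)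
    (hC : 0 ≤ C) {L : (HalfLine → ℂ) →ₗ[ℂ] ℂ} (hL : ∀ a, IsHardyAtom p a → ‖L a‖ ≤ C) :
    ∃ (B : ℝ) (f : HalfLine → ℂ), HolderPlusBound ((1 - p) / p) B f ∧
      ∀ a, IsHardyAtom p a → L a = ∫ x, f x * a x := by
  have hα : 0 < (1 - p) / p := div_pos (by linarith) hp0
  have he : -1 / p = -(1 + (1 - p) / p) := by field_simp; ring
  have hAB : AtomBound ((1 - p) / p) C L := by
    refine ⟨hC, fun u v M g hu huv hM hm hs hI hb => ?_, fun v hv => ?_⟩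
    · have hr : 0 < (v - u) ^ (1 + (1 - p) / p) := Real.rpow_pos_of_pos (sub_pos.2 huv) _
      set r := (v - u) ^ (1 + (1 - p) / p) with hrdef
      have hMr : ((M * r : ℝ) : ℂ) ≠ 0 := Complex.ofReal_ne_zero.2 (by positivity)
      have hat : IsHardyAtom p (((M * r : ℝ) : ℂ)⁻¹ • g) := by
        refine Or.inl ⟨u, v, hu, huv, hm.const_smul _, fun x hx => ?_, ?_, ?_⟩
        · simp [support_Icc_of_support_halfIco hs x hx]
        · have : ∫ x, (((M * r : ℝ) : ℂ)⁻¹ • g) x = ∫ x, ((M * r : ℝ) : ℂ)⁻¹ * g x := rfl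
          rw [this, integral_const_mul, hI, mul_zero]
        · rw [eLpNorm_exponent_top]
          refine eLpNormEssSup_le_of_ae_bound ?_
          filter_upwards [hb] with x hx
          rw [Pi.smul_apply, norm_smul, norm_inv, Complex.norm_real,
            Real.norm_of_nonneg (by positivity), he, Real.rpow_neg (by linarith), ← hrdef,
            mul_inv, mul_right_comm]
          refine mul_le_of_le_one_left (by positivity) ?_
          rw [inv_mul_le_iff₀ hM, mul_one]
          exact hx
      have := hL _ hat
      rw [map_smul, norm_smul, norm_inv, Complex.norm_real, Real.norm_of_nonneg (by positivity),
        inv_mul_le_iff₀ (by positivity)] at this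
      linarith
    · have hr : 0 < v ^ (1 + (1 - p) / p) := Real.rpow_pos_of_pos hv _
      have hat : IsHardyAtom p (((v ^ (-1 / p) : ℝ) : ℂ) • halfChi 0 v) := by
        refine Or.inr ⟨v, hv, ?_⟩
        ext x
        have hx : (0 : ℝ) < x := x.2
        by_cases hxv : (x : ℝ) < v
        · rw [Pi.smul_apply, halfChi_of_mem ⟨hx.le, hxv⟩, Set.indicator_of_mem (by exact hxv)]
          simp
        · rw [Pi.smul_apply, halfChi_of_notMem fun h => hxv h.2,
            Set.indicator_of_notMem (by exact hxv), smul_zero]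
      have := hL _ hat
      rw [map_smul, norm_smul, Complex.norm_real, he, Real.rpow_neg hv.le,
        Real.norm_of_nonneg (by positivity), inv_mul_le_iff₀ hr] at this
      linarith
  obtain ⟨K, f, hK0, hK⟩ := hAB.exists_limit hα
  have hf := hAB.holderPlusBound hK0 hK
  refine ⟨_, f, hf, fun a ha => ?_⟩
  obtain ⟨u, v, M, hu, huv, hM, hm, hs, hb⟩ := ha.exists_support
  exact hAB.apply_eq_integral hα hK0 hK hf hu huv hM hm hs hb

/-! ### Schwartz approximation of Hölder functions -/

open scoped ContDiff in
/-- Mollification of a compactly supported Hölder function by a kernel supported in `(0, ε)`. -/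
theorem exists_schwartzHalfLine_near {α K ε R : ℝ} (hα : 0 < α) (hε : 0 < ε) {G : ℝ → ℂ}
    (hG : ∀ x y, ‖G x - G y‖ ≤ K * |x - y| ^ α) (h0 : ∀ x ≤ 0, G x = 0) (hR : ∀ x ≥ R, G x = 0) :
    ∃ φ : schwartzHalfLine, (∀ x y : ℝ, ‖(φ : 𝓢(ℝ, ℂ)) x - (φ : 𝓢(ℝ, ℂ)) y‖ ≤ K * |x - y| ^ α) ∧
      ∀ x : ℝ, ‖(φ : 𝓢(ℝ, ℂ)) x - G x‖ ≤ K * ε ^ α := by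
  have hGc : Continuous G := continuous_of_norm_sub_le hα fun x y => hG x y
  have hGs : HasCompactSupport G := by
    refine HasCompactSupport.intro (isCompact_Icc (a := (0 : ℝ)) (b := R)) fun x hx => ?_
    by_contra hne
    refine hx ⟨?_, ?_⟩
    · by_contra hc
      exact hne (h0 x (not_le.1 hc).le)
    · by_contra hc
      exact hne (hR x (not_le.1 hc).le)
  -- The kernel lives in `(0, ε)`, so the convolution at `x` sees only values of `G` to the left of
  -- `x` and still vanishes for `x ≤ 0`.
  let ρ : ContDiffBump (ε / 2) := ⟨ε / 4, ε / 2, by linarith, by linarith⟩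
  let w : ℝ → ℝ := ρ.normed volume
  have hw0 : ∀ t, 0 ≤ w t := ρ.nonneg_normed
  have hwi : Integrable w := ρ.integrable_normed
  have hw1 : ∫ t, w t = 1 := ρ.integral_normed
  have hwc : Continuous w := ρ.continuous_normed
  have hws : ∀ t, w t ≠ 0 → 0 < t ∧ t < ε := fun t ht => by
    have h : t ∈ Function.support w := ht
    rw [show Function.support w = Metric.ball (ε / 2) (ε / 2) from ρ.support_normed_eq,
      Real.ball_eq_Ioo] at h
    exact ⟨by linarith [h.1], by linarith [h.2]⟩
  let Φ : ℝ → ℂ := convolution w G (ContinuousLinearMap.lsmul ℝ ℝ) volume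
  have hΦ : ∀ x, Φ x = ∫ t, w t • G (x - t) := fun x => rfl
  have hint : ∀ x, Integrable fun t => w t • G (x - t) := fun x =>
    (hwc.smul (hGc.comp (continuous_const.sub continuous_id))).integrable_of_hasCompactSupport
      (ρ.hasCompactSupport_normed.smul_right)
  have hbound : ∀ (F : ℝ → ℂ) (M : ℝ), (∀ t, w t ≠ 0 → ‖F t‖ ≤ M) → ‖∫ t, w t • F t‖ ≤ M := by
    intro F M hF
    refine (norm_integral_le_of_norm_le (hwi.mul_const M) (Eventually.of_forall fun t => ?_)).trans_eq
      (by rw [integral_mul_const, hw1, one_mul])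
    rw [norm_smul, Real.norm_of_nonneg (hw0 t)]
    by_cases ht : w t = 0
    · simp [ht]
    · exact mul_le_mul_of_nonneg_left (hF t ht) (hw0 t)
  have hsm : ContDiff ℝ ∞ Φ :=
    HasCompactSupport.contDiff_convolution_left (n := ⊤) _ ρ.hasCompactSupport_normed
      ρ.contDiff_normed hGc.locallyIntegrable
  have hcs : HasCompactSupport Φ := HasCompactSupport.convolution _ ρ.hasCompactSupport_normed hGs
  refine ⟨⟨hcs.toSchwartzMap hsm, fun x hx => ?_⟩, fun x y => ?_, fun x => ?_⟩
  · change Φ x = 0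
    rw [hΦ]
    refine integral_eq_zero_of_ae (Eventually.of_forall fun t => ?_)
    by_cases ht : w t = 0
    · simp [ht]
    · simp [h0 (x - t) (by linarith [(hws t ht).1])]
  · change ‖Φ x - Φ y‖ ≤ _
    rw [hΦ, hΦ, ← integral_sub (hint x) (hint y)]
    simp only [← smul_sub]
    refine hbound _ _ fun t _ => (hG _ _).trans_eq ?_
    rw [sub_sub_sub_cancel_right]
  · change ‖Φ x - G x‖ ≤ _
    have : G x = ∫ t, w t • G x := by rw [integral_smul_const, hw1, one_smul]
    rw [hΦ, this, ← integral_sub (hint x) (hwi.smul_const _)]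
    simp only [← smul_sub]
    refine hbound _ _ fun t ht => (hG _ _).trans ?_
    have hK : 0 ≤ K := by
      have := (norm_nonneg _).trans (hG 1 0)
      simpa using this
    refine mul_le_mul_of_nonneg_left (Real.rpow_le_rpow (abs_nonneg _) ?_ hα.le) hK
    rw [sub_sub_cancel_left, abs_neg, abs_of_pos (hws t ht).1]
    exact (hws t ht).2.le

/-- The growth bound is exactly what keeps the extension by zero Hölder with the same constant
across the origin. Truncation is done by composing with the 1-Lipschitz map `x ↦ min x (2 * n - x)`,
which is `x` up to `n` and nonpositive from `2 * n` on; unlike a multiplicative cutoff it does not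
increase the constant, and neither does mollification. -/
theorem HolderPlusBound.exists_schwartz_approx {α K : ℝ} (hα : 0 < α) {f : HalfLine → ℂ}
    (hf : HolderPlusBound α K f) : ∃ φ : ℕ → schwartzHalfLine,
      (∀ n, HolderPlusBound α K fun x : HalfLine => (φ n : 𝓢(ℝ, ℂ)) x) ∧
      ∀ x : HalfLine, Tendsto (fun n => (φ n : 𝓢(ℝ, ℂ)) x) atTop (𝓝 (f x)) := by
  let F : ℝ → ℂ := fun x => if h : 0 < x then f ⟨x, h⟩ else 0
  have hFpos : ∀ x : HalfLine, F x = f x := fun x => dif_pos x.2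
  have hFneg : ∀ x : ℝ, x ≤ 0 → F x = 0 := fun x hx => dif_neg (not_lt.2 hx)
  have hF1 : ∀ x y : ℝ, y ≤ 0 → ‖F x - F y‖ ≤ K * |x - y| ^ α := fun x y hy => by
    have hK := hf.nonneg
    rw [hFneg y hy, sub_zero]
    by_cases hx : 0 < x
    · rw [hFpos ⟨x, hx⟩]
      refine (hf.norm_le ⟨x, hx⟩).trans (mul_le_mul_of_nonneg_left ?_ hK)
      exact Real.rpow_le_rpow hx.le (by rw [abs_of_pos (by linarith)]; linarith) hα.le
    · rw [hFneg x (not_lt.1 hx), norm_zero]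
      positivity
  have hF : ∀ x y : ℝ, ‖F x - F y‖ ≤ K * |x - y| ^ α := fun x y => by
    by_cases hy : 0 < y
    · by_cases hx : 0 < x
      · rw [hFpos ⟨x, hx⟩, hFpos ⟨y, hy⟩]
        exact hf.norm_sub_le _ _
      · rw [norm_sub_rev, abs_sub_comm]
        exact hF1 y x (not_lt.1 hx)
    · exact hF1 x y (not_lt.1 hy)
  have hmain : ∀ n : ℕ, ∃ φ : schwartzHalfLine,
      (∀ x y : ℝ, ‖(φ : 𝓢(ℝ, ℂ)) x - (φ : 𝓢(ℝ, ℂ)) y‖ ≤ K * |x - y| ^ α) ∧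
      ∀ x : ℝ, ‖(φ : 𝓢(ℝ, ℂ)) x - F (min x (2 * n - x))‖ ≤ K * (1 / ((n : ℝ) + 1)) ^ α := by
    intro n
    refine exists_schwartzHalfLine_near (G := fun x => F (min x (2 * n - x))) (R := 2 * n) hα
      Nat.one_div_pos_of_nat (fun x y => (hF _ _).trans ?_) (fun x hx => ?_) fun x hx => ?_
    · refine mul_le_mul_of_nonneg_left (Real.rpow_le_rpow (abs_nonneg _) ?_ hα.le) hf.nonneg
      refine (abs_min_sub_min_le_max _ _ _ _).trans (max_le le_rfl ?_)
      rw [sub_sub_sub_cancel_left, abs_sub_comm]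
    · exact hFneg _ ((min_le_left _ _).trans hx)
    · exact hFneg _ ((min_le_right _ _).trans (by linarith))
  choose φ hφ1 hφ2 using hmain
  refine ⟨φ, fun n => ⟨hf.nonneg, fun x y => hφ1 n x y, fun x => ?_⟩, fun x => ?_⟩
  · have hx : (0 : ℝ) < x := x.2
    -- The growth bound is the Hölder bound against the point `0`, where `φ n` vanishes.
    have := hφ1 n x 0
    rwa [(φ n).2 0 le_rfl, sub_zero, sub_zero, abs_of_pos hx] at this
  · refine tendsto_iff_norm_sub_tendsto_zero.2 ?_
    have hlim : Tendsto (fun n : ℕ => K * (1 / ((n : ℝ) + 1)) ^ α) atTop (𝓝 0) := by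
      simpa [Real.zero_rpow hα.ne'] using ((tendsto_one_div_add_atTop_nhds_zero_nat
        (𝕜 := ℝ)).rpow_const (p := α) (Or.inr hα.le)).const_mul K
    refine squeeze_zero' (Eventually.of_forall fun _ => norm_nonneg _) ?_ hlim
    filter_upwards [eventually_ge_atTop ⌈(x : ℝ)⌉₊] with n hn
    have hxn : (x : ℝ) ≤ n := Nat.ceil_le.1 hn
    have := hφ2 n x
    rwa [min_eq_left (by linarith), hFpos] at this

/-! ### Pairing with atoms and summability of coefficients -/

theorem IsHardyAtom.integrable_mul {p α K : ℝ} (hα : 0 < α) {f a : HalfLine → ℂ}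
    (hf : HolderPlusBound α K f) (ha : IsHardyAtom p a) : Integrable fun x => f x * a x := by
  obtain ⟨u, v, M, -, -, -, -, hs, -⟩ := ha.exists_support
  exact hf.integrable_mul (v := v) hα ha.integrable
    fun x hx => hs x fun hx' => not_lt.2 hx'.2.le hx

/-- The powers of the length cancel: `α` from `f`, `-1 / p` from the atom and `1` from the measure
of the interval. -/
theorem IsHardyAtom.norm_integral_mul_le {p K : ℝ} (hp0 : 0 < p) (hp1 : p < 1)
    {f a : HalfLine → ℂ} (hf : HolderPlusBound ((1 - p) / p) K f) (ha : IsHardyAtom p a) :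
    ‖∫ x, f x * a x‖ ≤ K := by
  have hα : 0 < (1 - p) / p := div_pos (by linarith) hp0
  have hK := hf.nonneg
  have hpow : ∀ t : ℝ, 0 < t → K * t ^ ((1 - p) / p) * t ^ (-1 / p) * t = K := by
    intro t ht
    have e : (1 - p) / p + -1 / p = -1 := by field_simp; ring
    rw [mul_assoc K, ← Real.rpow_add ht, e, Real.rpow_neg_one, mul_assoc, inv_mul_cancel₀ ht.ne',
      mul_one]
  have hfa := ha.integrable_mul hα hf
  have hai := ha.integrable
  rcases ha with ⟨b, c, hb, hbc, hm, hs, hI, hn⟩ | ⟨b, hb, rfl⟩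
  · have hcb : 0 < c - b := sub_pos.2 hbc
    have hcb' : 0 < (c - b) ^ (-1 / p) := Real.rpow_pos_of_pos hcb _
    -- The constant subtracted is the value at the right end, since `b` may be `0` and lie outside
    -- the half-line.
    let c' : HalfLine := ⟨c, hb.trans_lt hbc⟩
    have hsub : ∫ x, f x * a x = ∫ x, (f x - f c') * a x := by
      simp only [sub_mul]
      rw [integral_sub hfa (hai.const_mul _), integral_const_mul, hI, mul_zero, sub_zero]
    rw [hsub]
    refine (norm_integral_le_of_support_Icc
      (M := K * (c - b) ^ ((1 - p) / p) * (c - b) ^ (-1 / p)) hbc.le (by positivity)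
      (fun x hx => by rw [hs x hx, mul_zero]) ?_).trans_eq (hpow _ hcb)
    filter_upwards [ae_le_eLpNormEssSup (f := a) (μ := volume)] with x hx
    rw [eLpNorm_exponent_top] at hn
    have hax := hx.trans hn
    rw [← ofReal_norm, ENNReal.ofReal_le_ofReal_iff hcb'.le] at hax
    by_cases hxI : (x : ℝ) ∈ Set.Icc b c
    · rw [norm_mul]
      refine mul_le_mul ((hf.norm_sub_le x c').trans (mul_le_mul_of_nonneg_left ?_ hK)) hax
        (norm_nonneg _) (by positivity)
      refine Real.rpow_le_rpow (abs_nonneg _) ?_ hα.le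
      rw [abs_sub_comm, abs_of_nonneg (sub_nonneg.2 hxI.2)]
      exact sub_le_sub_left hxI.1 _
    · rw [hs x hxI, mul_zero, norm_zero]
      positivity
  · have hb' : 0 < b ^ (-1 / p) := Real.rpow_pos_of_pos hb _
    refine (norm_integral_le_of_support_Icc (b := 0) (c := b)
      (M := K * b ^ ((1 - p) / p) * b ^ (-1 / p)) hb.le (by positivity)
      (fun x hx => ?_) (Eventually.of_forall fun x => ?_)).trans_eq (by rw [sub_zero, hpow _ hb])
    · have hxb : ¬ (x : ℝ) < b := fun hx' => hx ⟨le_of_lt x.2, hx'.le⟩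
      simp [Set.indicator, hxb]
    · have hx0 : (0 : ℝ) < x := x.2
      by_cases hxb : (x : ℝ) < b
      · rw [norm_mul, Set.indicator_of_mem (by exact hxb), Complex.norm_real,
          Real.norm_of_nonneg hb'.le]
        refine mul_le_mul_of_nonneg_right ((hf.norm_le x).trans ?_) hb'.le
        exact mul_le_mul_of_nonneg_left (Real.rpow_le_rpow hx0.le hxb.le hα.le) hK
      · rw [Set.indicator_of_notMem (by exact hxb), mul_zero, norm_zero]
        positivity

/-- Each `x i ^ p` is at most the sum `S`, so `x i = x i ^ (1 - p) * x i ^ p ≤ S ^ ((1 - p) / p) * x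
i ^ p`; summing gives the exponent `1 / p`. -/
theorem summable_of_summable_rpow {p : ℝ} (hp0 : 0 < p) (hp1 : p < 1) {x : ℕ → ℝ}
    (hx : ∀ i, 0 ≤ x i) (h : Summable fun i => x i ^ p) :
    Summable x ∧ ∑' i, x i ≤ (∑' i, x i ^ p) ^ (1 / p) := by
  have hxp : ∀ i, 0 ≤ x i ^ p := fun i => Real.rpow_nonneg (hx i) p
  set S := ∑' i, x i ^ p with hS
  have hS0 : 0 ≤ S := tsum_nonneg hxp
  have hle : ∀ i, x i ≤ S ^ ((1 - p) / p) * x i ^ p := by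
    intro i
    have h1 : x i ^ p ≤ S := h.le_tsum i fun j _ => hxp j
    have h2 : (x i ^ p) ^ ((1 - p) / p) ≤ S ^ ((1 - p) / p) :=
      Real.rpow_le_rpow (hxp i) h1 (div_nonneg (by linarith) hp0.le)
    rw [← Real.rpow_mul (hx i), mul_div_cancel₀ _ hp0.ne'] at h2
    calc x i = x i ^ (1 - p) * x i ^ p := by
          rw [← Real.rpow_add_of_nonneg (hx i) (by linarith) hp0.le]; simp
      _ ≤ _ := mul_le_mul_of_nonneg_right h2 (hxp i)
  have hsum : Summable x := Summable.of_nonneg_of_le hx hle (h.mul_left _)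
  refine ⟨hsum, (hsum.tsum_le_tsum hle (h.mul_left _)).trans_eq ?_⟩
  rw [tsum_mul_left, ← hS]
  nth_rewrite 2 [← Real.rpow_one S]
  rw [← Real.rpow_add_of_nonneg hS0 (div_nonneg (by linarith) hp0.le) zero_le_one]
  congr 1
  field_simp
  ring

/-! ### The quasi-norm, atoms and tails of decompositions -/

theorem hardyNorm_nonneg (p : ℝ) (u : TemperedHalfLine) : 0 ≤ hardyNorm p u := by
  refine Real.sInf_nonneg ?_
  rintro r ⟨α, a, -, rfl⟩
  exact Real.rpow_nonneg (tsum_nonneg fun i => Real.rpow_nonneg (norm_nonneg _) _) _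

theorem IsAtomicDecomposition.hardyNorm_le {p : ℝ} {u : TemperedHalfLine} {α : ℕ → ℂ}
    {a : ℕ → HalfLine → ℂ} (h : IsAtomicDecomposition p u α a) :
    hardyNorm p u ≤ (∑' i, ‖α i‖ ^ p) ^ (1 / p) := by
  refine csInf_le ⟨0, ?_⟩ ⟨α, a, h, rfl⟩
  rintro r ⟨α, a, -, rfl⟩
  exact Real.rpow_nonneg (tsum_nonneg fun i => Real.rpow_nonneg (norm_nonneg _) _) _

theorem IsHardyAtom.mem_atomSpan {p : ℝ} {a : HalfLine → ℂ} (ha : IsHardyAtom p a) :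
    a ∈ atomSpan p :=
  Submodule.subset_span ha

theorem atomSpanToHardy_apply {p : ℝ} (hp : 1 / 2 < p) (g : atomSpan p) (φ : schwartzHalfLine) :
    (atomSpanToHardy p hp g : TemperedHalfLine) φ =
      ∫ x : HalfLine, (g : HalfLine → ℂ) x * (φ : 𝓢(ℝ, ℂ)) (x : ℝ) :=
  rfl

theorem IsHardyAtom.isAtomicDecomposition {p : ℝ} (hp : 1 / 2 < p) {a : HalfLine → ℂ}
    (ha : IsHardyAtom p a) :
    IsAtomicDecomposition p (atomSpanToHardy p hp ⟨a, ha.mem_atomSpan⟩ : TemperedHalfLine)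
      (fun i => if i = 0 then 1 else 0) (fun _ => a) := by
  refine ⟨fun _ => ha, ?_, fun φ => ?_⟩
  · refine summable_of_ne_finset_zero (s := {0}) fun i hi => ?_
    have h0 : i ≠ 0 := by simpa using hi
    have : p ≠ 0 := by linarith
    simp [h0, Real.zero_rpow this]
  · refine tendsto_const_nhds.congr' ?_
    filter_upwards [eventually_gt_atTop 0] with n hn
    rw [atomSpanToHardy_apply]
    simp [hn.ne']

theorem IsHardyAtom.hardyNorm_le_one {p : ℝ} (hp : 1 / 2 < p) {a : HalfLine → ℂ}
    (ha : IsHardyAtom p a) :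
    hardyNorm p (atomSpanToHardy p hp ⟨a, ha.mem_atomSpan⟩ : TemperedHalfLine) ≤ 1 := by
  refine (ha.isAtomicDecomposition hp).hardyNorm_le.trans_eq ?_
  have hp0 : p ≠ 0 := by linarith
  rw [tsum_eq_single 0 fun i hi => by simp [hi, Real.zero_rpow hp0]]
  simp

/-- The remainder after `n` terms of an atomic decomposition is decomposed by the tail. -/
theorem IsAtomicDecomposition.sub_sum {p : ℝ} (hp : 1 / 2 < p) {u : TemperedHalfLine} {α : ℕ → ℂ}
    {a : ℕ → HalfLine → ℂ} (h : IsAtomicDecomposition p u α a) (n : ℕ) :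
    IsAtomicDecomposition p (u - ∑ i ∈ Finset.range n,
        α i • (atomSpanToHardy p hp ⟨a i, (h.1 i).mem_atomSpan⟩ : TemperedHalfLine))
      (fun i => α (i + n)) (fun i => a (i + n)) := by
  refine ⟨fun i => h.1 _, (summable_nat_add_iff n).2 h.2.1, fun φ => ?_⟩
  have h1 := ((tendsto_add_atTop_iff_nat n).2 (h.2.2 φ)).sub_const
    (∑ i ∈ Finset.range n, α i * ∫ x, a i x * (φ : 𝓢(ℝ, ℂ)) (x : ℝ))
  have h2 : (u - ∑ i ∈ Finset.range n,
      α i • (atomSpanToHardy p hp ⟨a i, (h.1 i).mem_atomSpan⟩ : TemperedHalfLine)) φ =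
      u φ - ∑ i ∈ Finset.range n, α i * ∫ x, a i x * (φ : 𝓢(ℝ, ℂ)) (x : ℝ) := by
    simp [atomSpanToHardy_apply]
  rw [h2]
  refine h1.congr fun m => ?_
  rw [add_comm m n, Finset.sum_range_add, add_sub_cancel_left]
  simp only [add_comm n]

/-- A bounded functional on `H^p` which vanishes on atoms is zero. -/
theorem eq_zero_of_apply_atom_eq_zero {p : ℝ} (hp : 1 / 2 < p)
    {D : hardySpace p hp →ₗ[ℂ] ℂ} (hD : D ∈ hardyDual p hp)
    (h0 : ∀ g : atomSpan p, D (atomSpanToHardy p hp g) = 0) : D = 0 := by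
  have hp0 : 0 < p := by linarith
  obtain ⟨C, hC⟩ := hD
  ext u
  obtain ⟨α, a, hdec⟩ := u.2
  -- The first `n` terms contribute nothing to `D u`, so only the quasi-norm of the tail matters.
  have key : ∀ n : ℕ, ‖D u‖ ≤ |C| * (∑' i, ‖α (i + n)‖ ^ p) ^ (1 / p) := by
    intro n
    set s : hardySpace p hp := ∑ i ∈ Finset.range n,
      α i • atomSpanToHardy p hp ⟨a i, (hdec.1 i).mem_atomSpan⟩ with hs
    have hDs : D s = 0 := by
      rw [hs, map_sum]
      refine Finset.sum_eq_zero fun i _ => ?_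
      rw [map_smul, h0, smul_zero]
    have hus : ((u - s : hardySpace p hp) : TemperedHalfLine) = u - ∑ i ∈ Finset.range n,
        α i • (atomSpanToHardy p hp ⟨a i, (hdec.1 i).mem_atomSpan⟩ : TemperedHalfLine) := by
      simp [hs]
    have hle := (hdec.sub_sum hp n).hardyNorm_le
    rw [← hus] at hle
    calc ‖D u‖ = ‖D (u - s)‖ := by rw [LinearMap.map_sub D u s, hDs, sub_zero]
      _ ≤ C * hardyNorm p (u - s : hardySpace p hp) := hC _
      _ ≤ |C| * hardyNorm p (u - s : hardySpace p hp) :=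
        mul_le_mul_of_nonneg_right (le_abs_self C) (hardyNorm_nonneg p _)
      _ ≤ _ := mul_le_mul_of_nonneg_left hle (abs_nonneg C)
  have hp' : 0 < 1 / p := by positivity
  have hlim := ((tendsto_sum_nat_add fun i => ‖α i‖ ^ p).rpow_const
    (p := 1 / p) (Or.inr hp'.le)).const_mul |C|
  rw [Real.zero_rpow hp'.ne', mul_zero] at hlim
  simpa using ge_of_tendsto' hlim key

theorem HolderPlusBound.integrable_mul_atomSpan {p α K : ℝ} (hα : 0 < α) {f : HalfLine → ℂ}
    (hf : HolderPlusBound α K f) (g : atomSpan p) :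
    Integrable fun y => f y * (g : HalfLine → ℂ) y := by
  obtain ⟨g, hg⟩ := g
  induction hg using Submodule.span_induction with
  | mem a ha => exact IsHardyAtom.integrable_mul hα hf ha
  | zero => simp
  | add g h _ _ h1 h2 =>
    refine (h1.add h2).congr (Eventually.of_forall fun x => ?_)
    simp [mul_add]
  | smul c g _ h1 => simpa [mul_left_comm] using h1.const_mul c

/-- Integration against a Hölder function, as a linear functional on finite linear combinations of
atoms. -/
noncomputable def holderPairing {p α K : ℝ} (hα : 0 < α) {f : HalfLine → ℂ}
    (hf : HolderPlusBound α K f) : atomSpan p →ₗ[ℂ] ℂ where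
  toFun g := ∫ y, f y * (g : HalfLine → ℂ) y
  map_add' g h := by
    rw [← integral_add (hf.integrable_mul_atomSpan hα g) (hf.integrable_mul_atomSpan hα h)]
    simp [mul_add]
  map_smul' c g := by
    simp only [SetLike.val_smul, Pi.smul_apply, smul_eq_mul, RingHom.id_apply, mul_left_comm _ c]
    exact integral_const_mul _ _

theorem ext_of_apply_atom {p : ℝ} {S T : atomSpan p →ₗ[ℂ] ℂ}
    (h : ∀ (a : HalfLine → ℂ) (ha : IsHardyAtom p a),
      S ⟨a, ha.mem_atomSpan⟩ = T ⟨a, ha.mem_atomSpan⟩) : S = T := by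
  ext ⟨g, hg⟩
  induction hg using Submodule.span_induction with
  | mem a ha => exact h a ha
  | zero => exact (map_zero S).trans (map_zero T).symm
  | add g k hg hk h1 h2 =>
    exact (map_add S ⟨g, hg⟩ ⟨k, hk⟩).trans ((congrArg₂ _ h1 h2).trans (map_add T _ _).symm)
  | smul c g hg h1 =>
    exact (map_smul S c ⟨g, hg⟩).trans ((congrArg _ h1).trans (map_smul T _ _).symm)

/-! ### Existence and uniqueness of the representing function -/

/-- Every bounded functional on `H^p` is given by a Hölder function. -/
theorem exists_holder_of_mem_hardyDual {p : ℝ} (hp : 1 / 2 < p) (hp1 : p < 1)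
    {T : hardySpace p hp →ₗ[ℂ] ℂ} (hT : T ∈ hardyDual p hp) :
    ∃ (K : ℝ) (f : HalfLine → ℂ), HolderPlusBound ((1 - p) / p) K f ∧
      ∀ g : atomSpan p, T (atomSpanToHardy p hp g) = ∫ y, f y * (g : HalfLine → ℂ) y := by
  have hp0 : 0 < p := by linarith
  have hα : 0 < (1 - p) / p := div_pos (by linarith) hp0
  obtain ⟨C, hC⟩ := hT
  -- A purely algebraic extension to all functions; only its values on the span of atoms, where it
  -- is bounded on atoms, are ever used.
  obtain ⟨L, hL⟩ := LinearMap.exists_extend (T ∘ₗ atomSpanToHardy p hp)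
  have hLg : ∀ g : atomSpan p, L g = T (atomSpanToHardy p hp g) := fun g =>
    LinearMap.congr_fun hL g
  obtain ⟨K, f, hf, hfL⟩ := exists_holderPlusBound_of_bounded_on_atoms (L := L) hp0 hp1
    (abs_nonneg C) fun a ha => by
      refine ((congrArg norm (hLg ⟨a, ha.mem_atomSpan⟩)).trans_le (hC _)).trans ?_
      refine (mul_le_mul_of_nonneg_right (le_abs_self C) (hardyNorm_nonneg p _)).trans ?_
      exact mul_le_of_le_one_right (abs_nonneg C) (ha.hardyNorm_le_one hp)
  refine ⟨K, f, hf, fun g => ?_⟩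
  have : T ∘ₗ atomSpanToHardy p hp = holderPairing hα hf :=
    ext_of_apply_atom fun a ha => (hLg ⟨a, ha.mem_atomSpan⟩).symm.trans (hfL a ha)
  exact LinearMap.congr_fun this g

/-- A Hölder function whose integrals against the functions `χ_{(0, b)}` vanish is zero. -/
theorem HolderPlusBound.eq_zero {α K : ℝ} (hα : 0 < α) {f : HalfLine → ℂ}
    (hf : HolderPlusBound α K f) (h0 : ∀ b : ℝ, 0 < b → ∫ y, f y * halfChi 0 b y = 0) :
    f = 0 := by
  ext x
  have hx : (0 : ℝ) < x := x.2
  have hK := hf.nonneg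
  have hint : ∀ u v : ℝ, Integrable fun y => f y * halfChi u v y := fun u v =>
    hf.integrable_mul (v := v) hα (integrable_halfChi u v)
      fun y hy => halfChi_of_notMem fun hy' => not_lt.2 hy.le hy'.2
  have key : ∀ n : ℕ, ‖f x‖ ≤ K * (1 / ((n : ℝ) + 1)) ^ α := by
    intro n
    have hδ : 0 < 1 / ((n : ℝ) + 1) := Nat.one_div_pos_of_nat
    set δ := 1 / ((n : ℝ) + 1)
    have hsplit : ∀ y, halfChi 0 (x + δ) y - halfChi 0 x y = halfChi x (x + δ) y := by
      intro y
      have hy : (0 : ℝ) < y := y.2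
      by_cases h1 : (y : ℝ) < x
      · rw [halfChi_of_mem ⟨hy.le, by linarith⟩, halfChi_of_mem ⟨hy.le, h1⟩,
          halfChi_of_notMem fun h => not_lt.2 h.1 h1, sub_self]
      · by_cases h2 : (y : ℝ) < x + δ
        · rw [halfChi_of_mem ⟨hy.le, h2⟩, halfChi_of_notMem fun h => h1 h.2,
            halfChi_of_mem ⟨not_lt.1 h1, h2⟩, sub_zero]
        · rw [halfChi_of_notMem fun h => h2 h.2, halfChi_of_notMem fun h => h1 h.2,
            halfChi_of_notMem fun h => h2 h.2, sub_zero]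
    have hz : ∫ y, f y * halfChi x (x + δ) y = 0 := by
      simp only [← hsplit, mul_sub]
      rw [integral_sub (hint _ _) (hint _ _), h0 _ (by linarith), h0 _ hx, sub_zero]
    -- The integral of `f` over `[x, x + δ)` vanishes, so `f x * δ` is the integral of an
    -- oscillation of size `δ ^ α`; dividing by `δ` leaves a bound that tends to zero.
    have h1 : ∫ y, (f x - f y) * halfChi x (x + δ) y = f x * (δ : ℂ) := by
      simp only [sub_mul]
      rw [integral_sub ((integrable_halfChi _ _).const_mul _) (hint _ _), hz, sub_zero,
        integral_const_mul, integral_halfChi hx.le (by linarith), add_sub_cancel_left]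
    have h2 : ‖∫ y, (f x - f y) * halfChi x (x + δ) y‖ ≤ K * δ ^ α * (x + δ - x) := by
      refine norm_integral_le_of_support_Icc (by linarith) (by positivity)
        (fun y hy => ?_) (Eventually.of_forall fun y => ?_)
      · rw [halfChi_of_notMem fun h => hy ⟨h.1, h.2.le⟩, mul_zero]
      · by_cases hy : y ∈ halfIco x (x + δ)
        · rw [halfChi_of_mem hy, mul_one, norm_sub_rev]
          refine (hf.norm_sub_le y x).trans (mul_le_mul_of_nonneg_left ?_ hK)
          refine Real.rpow_le_rpow (abs_nonneg _) ?_ hα.le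
          rw [abs_of_nonneg (sub_nonneg.2 hy.1)]
          linarith [hy.2]
        · rw [halfChi_of_notMem hy, mul_zero, norm_zero]
          positivity
    rw [h1, norm_mul, Complex.norm_real, Real.norm_of_nonneg hδ.le, add_sub_cancel_left] at h2
    exact le_of_mul_le_mul_right h2 hδ
  have hlim := ((tendsto_one_div_add_atTop_nhds_zero_nat (𝕜 := ℝ)).rpow_const
    (p := α) (Or.inr hα.le)).const_mul K
  rw [Real.zero_rpow hα.ne', mul_zero] at hlim
  exact norm_le_zero_iff.1 (ge_of_tendsto' hlim key)

theorem HolderPlusBound.sub {α K K' : ℝ} {f f' : HalfLine → ℂ} (hf : HolderPlusBound α K f)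
    (hf' : HolderPlusBound α K' f') : HolderPlusBound α (K + K') (f - f') := by
  refine ⟨add_nonneg hf.nonneg hf'.nonneg, fun x y => ?_, fun x => ?_⟩
  · rw [add_mul, Pi.sub_apply, Pi.sub_apply, sub_sub_sub_comm]
    exact (_root_.norm_sub_le _ _).trans (add_le_add (hf.norm_sub_le x y) (hf'.norm_sub_le x y))
  · rw [add_mul]
    exact (_root_.norm_sub_le _ _).trans (add_le_add (hf.norm_le x) (hf'.norm_le x))

theorem HolderPlusBound.eq_of_integral_eq {p α K K' : ℝ} (hα : 0 < α) {f f' : HalfLine → ℂ}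
    (hf : HolderPlusBound α K f) (hf' : HolderPlusBound α K' f')
    (h : ∀ g : atomSpan p, ∫ y, f y * (g : HalfLine → ℂ) y = ∫ y, f' y * (g : HalfLine → ℂ) y) :
    f = f' := by
  refine sub_eq_zero.1 ((hf.sub hf').eq_zero hα fun b hb => ?_)
  have hr : ((b ^ (-1 / p) : ℝ) : ℂ) ≠ 0 :=
    Complex.ofReal_ne_zero.2 (Real.rpow_pos_of_pos hb _).ne'
  have hat : IsHardyAtom p (Set.indicator {x : HalfLine | (x : ℝ) < b}
      (fun _ => ((b ^ (-1 / p) : ℝ) : ℂ))) := Or.inr ⟨b, hb, rfl⟩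
  have hg : halfChi 0 b = ((b ^ (-1 / p) : ℝ) : ℂ)⁻¹ • Set.indicator {x : HalfLine | (x : ℝ) < b}
      (fun _ => ((b ^ (-1 / p) : ℝ) : ℂ)) := by
    ext x
    have hx : (0 : ℝ) < x := x.2
    by_cases hxb : (x : ℝ) < b
    · rw [halfChi_of_mem ⟨hx.le, hxb⟩, Pi.smul_apply, Set.indicator_of_mem (by exact hxb),
        smul_eq_mul, inv_mul_cancel₀ hr]
    · rw [halfChi_of_notMem fun h => hxb h.2, Pi.smul_apply,
        Set.indicator_of_notMem (by exact hxb), smul_zero]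
  have hmem : halfChi 0 b ∈ atomSpan p := hg ▸ Submodule.smul_mem _ _ hat.mem_atomSpan
  have hsub : ∫ y, (f - f') y * halfChi 0 b y =
      ∫ y, (f y * halfChi 0 b y - f' y * halfChi 0 b y) := by
    simp only [Pi.sub_apply, sub_mul]
  rw [hsub, integral_sub (hf.integrable_mul_atomSpan hα ⟨_, hmem⟩)
    (hf'.integrable_mul_atomSpan hα ⟨_, hmem⟩), h ⟨_, hmem⟩, sub_self]

/-! ### The functional defined by a Hölder function -/

/-- Along Schwartz approximations of a Hölder function, a distribution in `H^p` converges to the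
sum of the pairings of its atoms. -/
theorem IsAtomicDecomposition.tendsto_apply {p K : ℝ} (hp : 1 / 2 < p) (hp1 : p < 1)
    {f : HalfLine → ℂ} (hf : HolderPlusBound ((1 - p) / p) K f) {φ : ℕ → schwartzHalfLine}
    (hφ : ∀ n, HolderPlusBound ((1 - p) / p) K fun x : HalfLine => (φ n : 𝓢(ℝ, ℂ)) x)
    (hlim : ∀ x : HalfLine, Tendsto (fun n => (φ n : 𝓢(ℝ, ℂ)) x) atTop (𝓝 (f x)))
    {u : TemperedHalfLine} {β : ℕ → ℂ} {a : ℕ → HalfLine → ℂ}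
    (h : IsAtomicDecomposition p u β a) :
    Tendsto (fun n => u (φ n)) atTop (𝓝 (∑' i, β i * ∫ x, f x * a i x)) ∧
      ‖∑' i, β i * ∫ x, f x * a i x‖ ≤ K * (∑' i, ‖β i‖ ^ p) ^ (1 / p) := by
  have hp0 : 0 < p := by linarith
  have hα : 0 < (1 - p) / p := div_pos (by linarith) hp0
  have hK := hf.nonneg
  obtain ⟨hβ, hβle⟩ := summable_of_summable_rpow hp0 hp1 (fun i => norm_nonneg (β i)) h.2.1
  have hterm : ∀ {k : HalfLine → ℂ}, HolderPlusBound ((1 - p) / p) K k → ∀ i,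
      ‖β i * ∫ x, k x * a i x‖ ≤ ‖β i‖ * K := fun {k} hk i => by
    rw [norm_mul]
    exact mul_le_mul_of_nonneg_left ((h.1 i).norm_integral_mul_le hp0 hp1 hk) (norm_nonneg _)
  have hu : ∀ n, u (φ n) = ∑' i, β i * ∫ x : HalfLine, (φ n : 𝓢(ℝ, ℂ)) x * a i x := by
    intro n
    have hs : Summable fun i => β i * ∫ x : HalfLine, (φ n : 𝓢(ℝ, ℂ)) x * a i x :=
      Summable.of_norm_bounded (hβ.mul_right K) (hterm (hφ n))
    refine tendsto_nhds_unique (h.2.2 (φ n)) (hs.hasSum.tendsto_sum_nat.congr fun m => ?_)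
    simp only [mul_comm]
  constructor
  · simp only [hu]
    -- The majorant `‖β i‖ * K` is uniform in `n` because all `φ n` share the constant `K`. The
    -- limit of each term is a second dominated convergence, on the bounded support of the atom.
    refine tendsto_tsum_of_dominated_convergence (hβ.mul_right K) (fun i => ?_)
      (Eventually.of_forall fun n i => hterm (hφ n) i)
    refine Tendsto.const_mul _ ?_
    obtain ⟨u, v, M, -, -, -, -, hs, -⟩ := (h.1 i).exists_support
    have hs' : ∀ x : HalfLine, v < x → a i x = 0 := fun x hx => hs x fun hx' => not_lt.2 hx'.2.le hx
    refine tendsto_integral_of_dominated_convergence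
      (fun x => K * |v| ^ ((1 - p) / p) * ‖a i x‖) (fun n => ?_)
      ((h.1 i).integrable.norm.const_mul _)
      (fun n => Eventually.of_forall ((hφ n).norm_mul_le hα hs'))
      (Eventually.of_forall fun x => (hlim x).mul_const _)
    exact ((hφ n).integrable_mul hα (h.1 i).integrable hs').aestronglyMeasurable
  · refine (tsum_of_norm_bounded (hβ.mul_right K).hasSum (hterm hf)).trans ?_
    rw [tsum_mul_right, mul_comm]
    exact mul_le_mul_of_nonneg_left hβle hK

/-- Every Hölder function defines a bounded functional on `H^p`. -/
theorem HolderPlusBound.exists_mem_hardyDual {p K : ℝ} (hp : 1 / 2 < p) (hp1 : p < 1)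
    {f : HalfLine → ℂ} (hf : HolderPlusBound ((1 - p) / p) K f) :
    ∃ T ∈ hardyDual p hp, ∀ g : atomSpan p,
      T (atomSpanToHardy p hp g) = ∫ y, f y * (g : HalfLine → ℂ) y := by
  have hp0 : 0 < p := by linarith
  have hα : 0 < (1 - p) / p := div_pos (by linarith) hp0
  obtain ⟨φ, hφ, hlim⟩ := hf.exists_schwartz_approx hα
  have hex : ∀ u : hardySpace p hp, ∃ z : ℂ,
      Tendsto (fun n => (u : TemperedHalfLine) (φ n)) atTop (𝓝 z) := fun u => by
    obtain ⟨β, a, h⟩ := u.2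
    exact ⟨_, (h.tendsto_apply hp hp1 hf hφ hlim).1⟩
  -- As a limit of `u (φ n)`, the value depends on the distribution `u` alone; linearity follows
  -- from uniqueness of limits.
  choose T hT using hex
  let T' : hardySpace p hp →ₗ[ℂ] ℂ :=
    { toFun := T
      map_add' := fun u w => tendsto_nhds_unique (hT _) ((hT u).add (hT w))
      map_smul' := fun c u => tendsto_nhds_unique (hT _) ((hT u).const_mul c) }
  have hdec : ∀ (u : hardySpace p hp) {β : ℕ → ℂ} {a : ℕ → HalfLine → ℂ},
      IsAtomicDecomposition p (u : TemperedHalfLine) β a →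
      T' u = ∑' i, β i * ∫ x, f x * a i x := fun u {β a} h =>
    tendsto_nhds_unique (hT u) (h.tendsto_apply hp hp1 hf hφ hlim).1
  refine ⟨T', ⟨K, fun u => ?_⟩, fun g => ?_⟩
  · obtain ⟨β, a, h⟩ := u.2
    have hle : ∀ r ∈ {r : ℝ | ∃ α a, IsAtomicDecomposition p (u : TemperedHalfLine) α a ∧
        r = (∑' i, ‖α i‖ ^ p) ^ (1 / p)}, ‖T' u‖ ≤ K * r := by
      rintro _ ⟨β, a, h, rfl⟩
      rw [hdec u h]
      exact (h.tendsto_apply hp hp1 hf hφ hlim).2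
    -- Passing to the infimum over decompositions divides by `K`, so `K = 0` is treated apart.
    rcases hf.nonneg.eq_or_lt with hK | hK
    · have := hle _ ⟨β, a, h, rfl⟩
      rwa [← hK, zero_mul] at this ⊢
    · rw [← div_le_iff₀' hK]
      exact le_csInf ⟨_, β, a, h, rfl⟩ fun r hr => (div_le_iff₀' hK).2 (hle r hr)
  · have : T' ∘ₗ atomSpanToHardy p hp = holderPairing hα hf := by
      refine ext_of_apply_atom fun a ha => ?_
      refine (hdec _ (ha.isAtomicDecomposition hp)).trans ?_
      rw [tsum_eq_single 0 fun i hi => by simp [hi], if_pos rfl, one_mul]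
      rfl
    exact LinearMap.congr_fun this g

theorem sub_mem_hardyDual {p : ℝ} (hp : 1 / 2 < p) {S T : hardySpace p hp →ₗ[ℂ] ℂ}
    (hS : S ∈ hardyDual p hp) (hT : T ∈ hardyDual p hp) : S - T ∈ hardyDual p hp := by
  obtain ⟨C, hC⟩ := hS
  obtain ⟨D, hD⟩ := hT
  refine ⟨C + D, fun u => ?_⟩
  rw [add_mul]
  exact (norm_sub_le _ _).trans (add_le_add (hC u) (hD u))

/-! ### The duality theorem -/

theorem theorem4 (p : ℝ) (hp : 1 / 2 < p) (hp1 : p < 1) :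
    (∀ T ∈ hardyDual p hp, ∃! f : HalfLine → ℂ, MemHolderPlus ((1 - p) / p) f ∧
      ∀ g : atomSpan p, Integrable (fun y : HalfLine => f y * (g : HalfLine → ℂ) y) ∧
        T (atomSpanToHardy p hp g) = ∫ y : HalfLine, f y * (g : HalfLine → ℂ) y) ∧
    (∀ f : HalfLine → ℂ, MemHolderPlus ((1 - p) / p) f →
      ∃! T : hardySpace p hp →ₗ[ℂ] ℂ, T ∈ hardyDual p hp ∧
        ∀ g : atomSpan p, Integrable (fun y : HalfLine => f y * (g : HalfLine → ℂ) y) ∧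
          T (atomSpanToHardy p hp g) = ∫ y : HalfLine, f y * (g : HalfLine → ℂ) y) := by
  have hα : 0 < (1 - p) / p := div_pos (by linarith) (by linarith)
  refine ⟨fun T hT => ?_, fun f hf => ?_⟩
  · obtain ⟨K, f, hf, hfT⟩ := exists_holder_of_mem_hardyDual hp hp1 hT
    refine ⟨f, ⟨hf.memHolderPlus hα, fun g => ⟨hf.integrable_mul_atomSpan hα g, hfT g⟩⟩, ?_⟩
    rintro f' ⟨hf', hfT'⟩
    obtain ⟨K', hf'⟩ := hf'.exists_bound hα
    exact hf'.eq_of_integral_eq hα hf fun g => (hfT' g).2.symm.trans (hfT g)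
  · obtain ⟨K, hf⟩ := hf.exists_bound hα
    obtain ⟨T, hT, hfT⟩ := hf.exists_mem_hardyDual hp hp1
    refine ⟨T, ⟨hT, fun g => ⟨hf.integrable_mul_atomSpan hα g, hfT g⟩⟩, ?_⟩
    rintro T' ⟨hT', hfT'⟩
    refine sub_eq_zero.1 (eq_zero_of_apply_atom_eq_zero hp (sub_mem_hardyDual hp hT' hT) fun g => ?_)
    rw [LinearMap.sub_apply, (hfT' g).2, hfT g, sub_self]
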